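/- All rings are commutative with identity and all sequences are finite. Let $R$ be a ring, $M$ an $R$-module and $\mathbf x=x_1,\dots,x_\ell$ a sequence in $R$. The sequence $\mathbf x$ is a \emph{weak $M$-regular sequence} if $x_i$ is a non-zero-divisor on $M/(x_1,\dots,x_{i-1})M$ for $i=1,\dots,\ell$; it is \emph{$M$-regular} if moreover $\mathbf xM\neq M$ (the empty sequence is regarded as regular on every module). For $n\ge 0$ write $\mathbf x^n=x_1^n,\dots,x_\ell^n$, and let $H_i(\mathbf x^n,M)$ be the homology of the Koszul complex $K_\bullet(\mathbf x^n,M)$. For $m\ge n$ let $\varphi^m_n:K_\bullet(\mathbf x^m,M)\to K_\bullet(\mathbf x^n,M)$ be the tensor product over $j=1,\dots,\ell$ of the chain maps from $0\to M\xrightarrow{x_j^m}M\to0$ to $0\to M\xrightarrow{x_j^n}M\to0$ given by multiplication by $x_j^{m-n}$ in degree $1$ and by the identity in degree $0$ (so in degree $i$, on the summand $M e_{j_1}\wedge\cdots\wedge e_{j_i}$, it is multiplication by $(x_{j_1}\cdots x_{j_i})^{m-n}$). The sequence $\mathbf x$ is \emph{$M$-weakly proregular} if for each $n$ there is $m\ge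 n$ such that $\varphi^m_n$ induces the zero map $H_i(\mathbf x^m,M)\to H_i(\mathbf x^n,M)$ for all $i\ge1$. Let $H^i_{\mathbf x}(M)$ be the $i$th cohomology of the \v{C}ech complex of $M$ with respect to $\mathbf x$. The sequence $\mathbf x$ is a \emph{parameter sequence on $M$} if it is $M$-weakly proregular, $\mathbf xM\ne M$, and $H^{\ell}_{\mathbf x}(M)_{\mathfrak p}\neq0$ for every prime $\mathfrak p\in\operatorname{Supp}_R(M/\mathbf xM)$; it is a \emph{strong parameter sequence on $M$} if $x_1,\dots,x_i$ is a parameter sequence on $M$ for $i=1,\dots,\ell$. A ring $S$ is \emph{Cohen--Macaulay} (in the sense of Hamilton and Marley) if every strong parameter sequence on $S$ is an $S$-regular sequence. The \emph{trivial extension} $R\ltimes M$ is the ring $R\oplus M$ with multiplication $(r,m)(r',m')=(rr',rm'+r'm)$. \textbf{Theorem.} Let $R$ be a ring and $M$ an $R$-module. \begin{enumerate} \item If every $R$-weakly proregular sequence is $M$-weakly proregular, then $R\ltimes M$ is Cohen--Macaulay if and only if $R$ is Cohen--Macaulay and every $R$-regular sequence is a weak $M$-regular sequence. \item Without any assumption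 on weakly proregular sequences: if $R$ is Cohen--Macaulay and every $R$-regular sequence is a weak $M$-regular sequence, then $R\ltimes M$ is Cohen--Macaulay. \end{enumerate} -/

import Mathlib

open CategoryTheory

universe u v

noncomputable section

namespace HamiltonMarley

/-- The subsets of `{1, …, ℓ}` with exactly `i` elements. -/
abbrev Subsets (ℓ i : ℕ) : Type := {s : Finset (Fin ℓ) // s.card = i}

/-- The sign `(-1) ^ #{k ∈ s | k < j}`. -/
def sgn (R : Type u) [CommRing R] {ℓ : ℕ} (j : Fin ℓ) (s : Finset (Fin ℓ)) : R :=
  (-1) ^ (s.filter (· < j)).card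

section Signs

variable (R : Type u) [CommRing R] {ℓ : ℕ}

theorem sgn_insert {j k : Fin ℓ} {s : Finset (Fin ℓ)} (hk : k ∉ s) :
    sgn R j (insert k s) = if k < j then -sgn R j s else sgn R j s := by
  unfold sgn
  rw [Finset.filter_insert]
  split_ifs with h
  · rw [Finset.card_insert_of_notMem (by simp [hk]), pow_succ]; ring
  · rfl

theorem sgn_swap {j k : Fin ℓ} {s : Finset (Fin ℓ)} (hjk : j ≠ k) (hj : j ∉ s) (hk : k ∉ s) :
    sgn R j s * sgn R k (insert j s) = -(sgn R k s * sgn R j (insert k s)) := by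
  rw [sgn_insert R hj, sgn_insert R hk]
  rcases lt_or_gt_of_ne hjk with h | h
  · rw [if_pos h, if_neg h.not_gt]; ring
  · rw [if_neg h.not_gt, if_pos h]; ring

theorem sgn_erase (j : Fin ℓ) (t : Finset (Fin ℓ)) : sgn R j (t.erase j) = sgn R j t := by
  unfold sgn
  congr 2
  ext k
  simp only [Finset.mem_filter, Finset.mem_erase]
  exact ⟨fun h => ⟨h.1.2, h.2⟩, fun h => ⟨⟨h.2.ne, h.1⟩, h.2⟩⟩

end Signs

/-! ### The Koszul complex -/

section Koszul

variable {R : Type u} [CommRing R] (M : Type v) [AddCommGroup M] [Module R M] {ℓ : ℕ}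

/-- The Koszul differential `K_{i+1}(x, M) → K_i(x, M)`, where `K_i(x, M)` is the direct sum of
copies of `M` with basis symbols `e_s`, `s` an `i`-element subset of `{1, …, ℓ}`; it sends
`m e_t` to `∑_{j ∈ t} (-1) ^ #{k ∈ t | k < j} x_j m e_{t ∖ j}`. -/
def koszulD (x : Fin ℓ → R) (i : ℕ) : (Subsets ℓ (i + 1) → M) →ₗ[R] (Subsets ℓ i → M) where
  toFun f s := ∑ j, if h : j ∈ s.1 then 0 else
    sgn R j s.1 • x j • f ⟨insert j s.1, by rw [Finset.card_insert_of_notMem h, s.2]⟩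
  map_add' f g := by
    ext s
    simp only [Pi.add_apply, ← Finset.sum_add_distrib]
    refine Finset.sum_congr rfl fun j _ => ?_
    split_ifs <;> simp
  map_smul' r f := by
    ext s
    simp only [Pi.smul_apply, RingHom.id_apply, Finset.smul_sum]
    refine Finset.sum_congr rfl fun j _ => ?_
    split_ifs
    · simp
    · rw [smul_comm (x j) r, smul_comm (sgn R j s.1) r]

theorem koszulD_apply (x : Fin ℓ → R) (i : ℕ) (f : Subsets ℓ (i + 1) → M) (s : Subsets ℓ i) :
    koszulD M x i f s = ∑ j, if h : j ∈ s.1 then 0 else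
      sgn R j s.1 • x j • f ⟨insert j s.1, by rw [Finset.card_insert_of_notMem h, s.2]⟩ := rfl

theorem koszulD_comp (x : Fin ℓ → R) (i : ℕ) :
    koszulD M x i ∘ₗ koszulD M x (i + 1) = 0 := by
  refine LinearMap.ext fun f => funext fun s => ?_
  let F : Fin ℓ → Fin ℓ → M := fun j k =>
    if h : j ∉ s.1 ∧ k ∉ s.1 ∧ j ≠ k then
      (sgn R j s.1 * sgn R k (insert j s.1)) • (x j * x k) • f ⟨insert k (insert j s.1), by
        rw [Finset.card_insert_of_notMem (by simp [h.2.1, Ne.symm h.2.2]),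
          Finset.card_insert_of_notMem h.1, s.2]⟩
    else 0
  have hF : ∀ j k, F j k + F k j = 0 := by
    intro j k
    by_cases h : j ∉ s.1 ∧ k ∉ s.1 ∧ j ≠ k
    · have h' : k ∉ s.1 ∧ j ∉ s.1 ∧ k ≠ j := ⟨h.2.1, h.1, h.2.2.symm⟩
      simp only [F, dif_pos h, dif_pos h']
      rw [sgn_swap R h.2.2 h.1 h.2.1, mul_comm (x j) (x k), neg_smul]
      have : insert k (insert j s.1) = insert j (insert k s.1) := Finset.insert_comm _ _ _
      simp only [this, neg_add_cancel]
    · have h' : ¬ (k ∉ s.1 ∧ j ∉ s.1 ∧ k ≠ j) := fun h' => h ⟨h'.2.1, h'.1, h'.2.2.symm⟩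
      simp only [F, dif_neg h, dif_neg h', add_zero]
  have key : (koszulD M x i (koszulD M x (i + 1) f)) s = ∑ p : Fin ℓ × Fin ℓ, F p.1 p.2 := by
    rw [koszulD_apply, Fintype.sum_prod_type]
    refine Finset.sum_congr rfl fun j _ => ?_
    by_cases hj : j ∈ s.1
    · rw [dif_pos hj, Finset.sum_eq_zero]
      intro k _
      exact dif_neg fun h => h.1 hj
    · rw [dif_neg hj, koszulD_apply, Finset.smul_sum, Finset.smul_sum]
      refine Finset.sum_congr rfl fun k _ => ?_
      by_cases hk : k ∈ insert j s.1
      · rw [dif_pos hk, smul_zero, smul_zero]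
        symm
        refine dif_neg fun h => ?_
        rcases Finset.mem_insert.1 hk with h1 | h1
        · exact h.2.2 h1.symm
        · exact h.2.1 h1
      · have h1 : k ≠ j ∧ k ∉ s.1 := by simpa using hk
        rw [dif_neg hk]
        simp only [F, dif_pos (show j ∉ s.1 ∧ k ∉ s.1 ∧ j ≠ k from ⟨hj, h1.2, h1.1.symm⟩)]
        simp only [smul_smul]
        congr 1
        ring
  rw [LinearMap.comp_apply, key]
  refine Finset.sum_involution (fun p _ => p.swap) (fun p _ => hF p.1 p.2) ?_
    (fun _ _ => Finset.mem_univ _) (fun p _ => p.swap_swap)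
  rintro ⟨j, k⟩ _ h1 h2
  obtain rfl : k = j := congrArg Prod.fst h2
  exact h1 (dif_neg fun h => h.2.2 rfl)

/-- The Koszul complex `K_•(x, M)`. -/
def koszulComplex (x : Fin ℓ → R) : ChainComplex (ModuleCat.{v} R) ℕ :=
  ChainComplex.of (fun i => ModuleCat.of R (Subsets ℓ i → M))
    (fun i => ModuleCat.ofHom (koszulD M x i))
    (fun i => by rw [← ModuleCat.ofHom_comp, koszulD_comp]; rfl)

/-- If `a j = c j * b j` for all `j`, the tensor product of the chain maps
`(M --a j--> M) ⟶ (M --b j--> M)` given by `c j` in degree one and by the identity in degree zero;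
in degree `i` it multiplies the `s`-component by `∏ j ∈ s, c j`. -/
def koszulScale (c : Fin ℓ → R) (i : ℕ) : (Subsets ℓ i → M) →ₗ[R] (Subsets ℓ i → M) where
  toFun f s := (∏ j ∈ s.1, c j) • f s
  map_add' f g := by ext s; simp
  map_smul' r f := by ext s; exact smul_comm _ r (f s)

theorem koszulScale_comm {a b c : Fin ℓ → R} (h : ∀ j, c j * b j = a j) (i : ℕ) :
    koszulD M b i ∘ₗ koszulScale M c (i + 1) = koszulScale M c i ∘ₗ koszulD M a i := by
  refine LinearMap.ext fun f => funext fun s => ?_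
  change koszulD M b i (koszulScale M c (i + 1) f) s = (∏ j ∈ s.1, c j) • koszulD M a i f s
  rw [koszulD_apply, koszulD_apply, Finset.smul_sum]
  refine Finset.sum_congr rfl fun j _ => ?_
  split_ifs with hj
  · simp
  · change sgn R j s.1 • b j • (∏ k ∈ insert j s.1, c k) • f _ = _
    rw [Finset.prod_insert hj, ← h j]
    simp only [smul_smul]
    congr 1
    ring

/-- The chain map `K_•(a, M) ⟶ K_•(b, M)` with components `koszulScale`. -/
def koszulMap {a b c : Fin ℓ → R} (h : ∀ j, c j * b j = a j) :
    koszulComplex M a ⟶ koszulComplex M b where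
  f i := ModuleCat.ofHom (koszulScale M c i)
  comm' i j hij := by
    obtain rfl : j + 1 = i := hij
    have hd (y : Fin ℓ → R) : (koszulComplex M y).d (j + 1) j = ModuleCat.ofHom (koszulD M y j) :=
      ChainComplex.of_d (fun i => ModuleCat.of R (Subsets ℓ i → M))
        (fun i => ModuleCat.ofHom (koszulD M y i)) j
    rw [hd, hd]
    exact ModuleCat.hom_ext (koszulScale_comm M h j)

/-- The transition map `φ_n^m : K_•(x^m, M) ⟶ K_•(x^n, M)` for `n ≤ m`. -/
def koszulTransition (x : Fin ℓ → R) {n m : ℕ} (h : n ≤ m) :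
    koszulComplex M (fun j => x j ^ m) ⟶ koszulComplex M (fun j => x j ^ n) :=
  koszulMap M (c := fun j => x j ^ (m - n)) (fun j => pow_sub_mul_pow (x j) h)

/-- The finite sequence `x` is `M`-weakly proregular: for each `n` there is `m ≥ n` such that
`φ_n^m` induces the zero map `H_i(x^m, M) → H_i(x^n, M)` for all `i ≥ 1`. -/
def IsWeaklyProregular (x : List R) : Prop :=
  ∀ n : ℕ, ∃ (m : ℕ) (h : n ≤ m), ∀ i : ℕ, 1 ≤ i →
    HomologicalComplex.homologyMap (koszulTransition M x.get h) i = 0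

end Koszul

/-! ### The Čech complex -/

section Cech

variable {R : Type u} [CommRing R] (M : Type v) [AddCommGroup M] [Module R M] {ℓ : ℕ}

/-- The localization of `M` at the powers of `∏ j ∈ s, x j`. -/
abbrev CechLoc (x : Fin ℓ → R) (s : Finset (Fin ℓ)) : Type (max u v) :=
  LocalizedModule (Submonoid.powers (∏ j ∈ s, x j)) M

theorem isUnit_cechLoc (x : Fin ℓ → R) {s t : Finset (Fin ℓ)} (h : s ⊆ t)
    (r : Submonoid.powers (∏ j ∈ s, x j)) :
    IsUnit (algebraMap R (Module.End R (CechLoc M x t)) r) := by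
  obtain ⟨r, n, rfl⟩ := r
  obtain ⟨c, hc⟩ := pow_dvd_pow_of_dvd (Finset.prod_dvd_prod_of_subset s t x h) n
  have hu : IsUnit (algebraMap R (Module.End R (CechLoc M x t)) ((∏ j ∈ t, x j) ^ n)) :=
    IsLocalizedModule.map_units (LocalizedModule.mkLinearMap
      (Submonoid.powers (∏ j ∈ t, x j)) M) (⟨_, n, rfl⟩ : Submonoid.powers (∏ j ∈ t, x j))
  rw [hc, map_mul] at hu
  exact ((Algebra.commute_algebraMap_left _ _).isUnit_mul_iff.1 hu).1

/-- The natural map between localizations for `s ⊆ t`. -/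
def cechRes (x : Fin ℓ → R) {s t : Finset (Fin ℓ)} (h : s ⊆ t) :
    CechLoc M x s →ₗ[R] CechLoc M x t :=
  LocalizedModule.lift _ (LocalizedModule.mkLinearMap _ M) (isUnit_cechLoc M x h)

theorem cechRes_comp (x : Fin ℓ → R) {s t w : Finset (Fin ℓ)} (h : s ⊆ t) (h' : t ⊆ w) :
    cechRes M x h' ∘ₗ cechRes M x h = cechRes M x (h.trans h') := by
  refine IsLocalizedModule.ext (Submonoid.powers (∏ j ∈ s, x j))
    (LocalizedModule.mkLinearMap (Submonoid.powers (∏ j ∈ s, x j)) M)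
    (isUnit_cechLoc M x (h.trans h')) ?_
  rw [LinearMap.comp_assoc]
  simp only [cechRes, LocalizedModule.lift_comp]

/-- The Čech differential `C^i(x; M) → C^{i+1}(x; M)`, where `C^i(x; M)` is the product, over the
`i`-element subsets `s` of `{1, …, ℓ}`, of the localizations of `M` at `∏ j ∈ s, x j`. -/
def cechD (x : Fin ℓ → R) (i : ℕ) :
    ((s : Subsets ℓ i) → CechLoc M x s.1) →ₗ[R] ((t : Subsets ℓ (i + 1)) → CechLoc M x t.1) where
  toFun f t := ∑ j, if h : j ∈ t.1 then
      sgn R j t.1 • cechRes M x (t.1.erase_subset j)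
        (f ⟨t.1.erase j, by rw [Finset.card_erase_of_mem h, t.2]; rfl⟩)
    else 0
  map_add' f g := by
    ext t
    simp only [Pi.add_apply, ← Finset.sum_add_distrib]
    refine Finset.sum_congr rfl fun j _ => ?_
    split_ifs <;> simp
  map_smul' r f := by
    ext t
    simp only [Pi.smul_apply, RingHom.id_apply, Finset.smul_sum]
    refine Finset.sum_congr rfl fun j _ => ?_
    split_ifs
    · rw [map_smul, smul_comm (sgn R j t.1) r]
    · simp

theorem cechD_apply (x : Fin ℓ → R) (i : ℕ) (f : (s : Subsets ℓ i) → CechLoc M x s.1)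
    (t : Subsets ℓ (i + 1)) :
    cechD M x i f t = ∑ j, if h : j ∈ t.1 then
      sgn R j t.1 • cechRes M x (t.1.erase_subset j)
        (f ⟨t.1.erase j, by rw [Finset.card_erase_of_mem h, t.2]; rfl⟩)
    else 0 := rfl

theorem cechRes_congr (x : Fin ℓ → R) {i : ℕ} (f : (s : Subsets ℓ i) → CechLoc M x s.1)
    {s s' t : Finset (Fin ℓ)} (e : s = s') (hs : s.card = i) (hs' : s'.card = i)
    (h : s ⊆ t) (h' : s' ⊆ t) :
    cechRes M x h (f ⟨s, hs⟩) = cechRes M x h' (f ⟨s', hs'⟩) := by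
  subst e
  rfl

theorem cechD_comp (x : Fin ℓ → R) (i : ℕ) :
    cechD M x (i + 1) ∘ₗ cechD M x i = 0 := by
  refine LinearMap.ext fun f => funext fun t => ?_
  let F : Fin ℓ → Fin ℓ → CechLoc M x t.1 := fun j k =>
    if h : j ∈ t.1 ∧ k ∈ t.1 ∧ j ≠ k then
      (sgn R j t.1 * sgn R k (t.1.erase j)) •
        cechRes M x (((t.1.erase j).erase_subset k).trans (t.1.erase_subset j))
          (f ⟨(t.1.erase j).erase k, by
            rw [Finset.card_erase_of_mem (Finset.mem_erase.2 ⟨h.2.2.symm, h.2.1⟩),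
              Finset.card_erase_of_mem h.1, t.2]; rfl⟩)
    else 0
  have hF : ∀ j k, F j k + F k j = 0 := by
    intro j k
    by_cases h : j ∈ t.1 ∧ k ∈ t.1 ∧ j ≠ k
    · have h' : k ∈ t.1 ∧ j ∈ t.1 ∧ k ≠ j := ⟨h.2.1, h.1, h.2.2.symm⟩
      simp only [F, dif_pos h, dif_pos h']
      have hs : sgn R j t.1 * sgn R k (t.1.erase j) =
          -(sgn R k t.1 * sgn R j (t.1.erase k)) := by
        have hj : j ∉ (t.1.erase j).erase k := by simp
        have hk : k ∉ (t.1.erase j).erase k := by simp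
        have e1 : insert k ((t.1.erase j).erase k) = t.1.erase j :=
          Finset.insert_erase (Finset.mem_erase.2 ⟨h.2.2.symm, h.2.1⟩)
        have e2 : insert j ((t.1.erase j).erase k) = t.1.erase k := by
          rw [Finset.erase_right_comm]
          exact Finset.insert_erase (Finset.mem_erase.2 ⟨h.2.2, h.1⟩)
        have := sgn_swap R h.2.2 hj hk
        rw [e1, e2] at this
        have a1 := sgn_erase R j (t.1.erase k)
        have a2 := sgn_erase R k (t.1.erase j)
        rw [Finset.erase_right_comm] at a1
        rw [a1, a2, sgn_erase, sgn_erase] at this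
        linear_combination this
      rw [hs, neg_smul, neg_add_eq_zero]
      rw [cechRes_congr M x f (Finset.erase_right_comm (a := j) (b := k))]
    · have h' : ¬ (k ∈ t.1 ∧ j ∈ t.1 ∧ k ≠ j) := fun h' => h ⟨h'.2.1, h'.1, h'.2.2.symm⟩
      simp only [F, dif_neg h, dif_neg h', add_zero]
  have key : (cechD M x (i + 1) (cechD M x i f)) t = ∑ p : Fin ℓ × Fin ℓ, F p.1 p.2 := by
    rw [cechD_apply, Fintype.sum_prod_type]
    refine Finset.sum_congr rfl fun j _ => ?_
    by_cases hj : j ∈ t.1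
    · rw [dif_pos hj, cechD_apply, map_sum, Finset.smul_sum]
      refine Finset.sum_congr rfl fun k _ => ?_
      by_cases hk : k ∈ t.1.erase j
      · have h1 : k ≠ j ∧ k ∈ t.1 := by simpa using hk
        rw [dif_pos hk]
        simp only [F, dif_pos (show j ∈ t.1 ∧ k ∈ t.1 ∧ j ≠ k from ⟨hj, h1.2, h1.1.symm⟩)]
        rw [map_smul, smul_smul, ← LinearMap.comp_apply, cechRes_comp]
      · rw [dif_neg hk, map_zero, smul_zero]
        symm
        refine dif_neg fun h => ?_
        exact hk (Finset.mem_erase.2 ⟨h.2.2.symm, h.2.1⟩)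
    · rw [dif_neg hj, Finset.sum_eq_zero]
      intro k _
      exact dif_neg fun h => hj h.1
  rw [LinearMap.comp_apply, key]
  refine Finset.sum_involution (fun p _ => p.swap) (fun p _ => hF p.1 p.2) ?_
    (fun _ _ => Finset.mem_univ _) (fun p _ => p.swap_swap)
  rintro ⟨j, k⟩ _ h1 h2
  obtain rfl : k = j := congrArg Prod.fst h2
  exact h1 (dif_neg fun h => h.2.2 rfl)

/-- The Čech complex `C(x; M)`. -/
def cechComplex (x : Fin ℓ → R) : CochainComplex (ModuleCat.{max u v} R) ℕ :=
  CochainComplex.of (fun i => ModuleCat.of R ((s : Subsets ℓ i) → CechLoc M x s.1))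
    (fun i => ModuleCat.ofHom (cechD M x i))
    (fun i => by rw [← ModuleCat.ofHom_comp, cechD_comp]; rfl)

/-- The `i`-th Čech cohomology module `H^i_x(M)`. -/
abbrev cechCohomology (x : List R) (i : ℕ) : ModuleCat.{max u v} R :=
  (cechComplex M x.get).homology i

end Cech

/-! ### Parameter sequences, regular sequences, Cohen–Macaulay modules -/

section CohenMacaulay

variable {R : Type u} [CommRing R] (M : Type v) [AddCommGroup M] [Module R M]

/-- The finite sequence `x` is a parameter sequence on `M`: it is `M`-weakly proregular,
`xM ≠ M`, and `H^ℓ_x(M)_p ≠ 0`, with `ℓ` the length of `x`, for all `p` in the support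
of `M/xM`. -/
structure IsParameterSequence (x : List R) : Prop where
  weaklyProregular : IsWeaklyProregular M x
  smul_top_ne : Ideal.ofList x • (⊤ : Submodule R M) ≠ ⊤
  nontrivial : ∀ p ∈ Module.support R (M ⧸ (Ideal.ofList x • (⊤ : Submodule R M))),
    Nontrivial (LocalizedModule p.asIdeal.primeCompl (cechCohomology M x x.length))

/-- Every nonempty initial segment is a parameter sequence on `M`. -/
def IsStrongParameterSequence (x : List R) : Prop :=
  ∀ i : ℕ, 1 ≤ i → i ≤ x.length → IsParameterSequence M (x.take i)

/-- `M`-regular sequences, with the convention that the empty sequence is regular on every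
module, including the zero module. -/
def IsRegularSequence (x : List R) : Prop :=
  x = [] ∨ RingTheory.Sequence.IsRegular M x

variable (R) in
/-- `M` is a Cohen–Macaulay `R`-module: every strong parameter sequence on `M` is
`M`-regular. -/
def IsCohenMacaulay : Prop :=
  ∀ x : List R, IsStrongParameterSequence M x → IsRegularSequence M x

/-- A ring is Cohen–Macaulay in the sense of Hamilton and Marley if it is Cohen–Macaulay as a
module over itself. -/
def IsCohenMacaulayRing (S : Type u) [CommRing S] : Prop :=
  IsCohenMacaulay S S

end CohenMacaulay

end HamiltonMarley

end

/-!
An element `s = (r, m)` of `R ⋉ M` differs from `(r, 0)` by an element of square zero, so `s` and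
`(r, 0)` divide each other's squares. Weak proregularity and the localizations of the top Čech
cohomology depend on a sequence only up to such a change, and `R ⋉ M` is `R × M` as an `R`-module
and has the same spectrum as `R`. Hence a sequence in `R ⋉ M` is a parameter sequence if and only
if its image in `R` is a parameter sequence on `R` and weakly proregular on `M`.

On the other side, the exact sequence `0 → M → R ⋉ M → R → 0`, which splits over `R`, relates
weak regularity on `R ⋉ M` to weak regularity on `R` and on `M`. The two sides are linked by the
fact that an `R`-regular sequence is a strong parameter sequence: its Koszul complexes are acyclic
in positive degrees, and `H^ℓ_x(R)_p` does not vanish because of the monomial property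
`s (x_1 ⋯ x_ℓ)^k ∈ (x_1^(k+1), …, x_ℓ^(k+1)) → s ∈ (x_1, …, x_ℓ)`.
-/

noncomputable section

namespace HamiltonMarley

/-! ### Weakly regular sequences -/

section WeaklyRegular

open RingTheory.Sequence Pointwise

variable {R : Type*} [CommRing R] {A B C M : Type*} [AddCommGroup A] [AddCommGroup B]
  [AddCommGroup C] [AddCommGroup M] [Module R A] [Module R B] [Module R C] [Module R M]

theorem isWeaklyRegular_of_exact {f : A →ₗ[R] B} {g : B →ₗ[R] C} {xs : List R}
    (hf : Function.Injective f) (hfg : Function.Exact f g) (hg : Function.Surjective g)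
    (hA : IsWeaklyRegular A xs) (hC : IsWeaklyRegular C xs) : IsWeaklyRegular B xs := by
  induction xs generalizing A B C with
  | nil => exact .nil R B
  | cons x xs ih =>
    rw [isWeaklyRegular_cons_iff] at hA hC ⊢
    have hinj : Function.Injective (QuotSMulTop.map x f) := by
      have h₀ := QuotSMulTop.map_first_exact_on_four_term_exact_of_isSMulRegular_last
        ((LinearMap.exact_zero_iff_injective PUnit f).2 hf) hfg hC.1
      rwa [map_zero, LinearMap.exact_zero_iff_injective] at h₀
    exact ⟨isSMulRegular_of_range_eq_ker hf (LinearMap.exact_iff.1 hfg).symm hA.1 hC.1,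
      ih hinj (QuotSMulTop.map_exact x hfg hg) (QuotSMulTop.map_surjective x hg) hA.2 hC.2⟩

theorem isWeaklyRegular_of_retract {f : A →ₗ[R] B} {g : B →ₗ[R] A} {xs : List R}
    (hgf : g ∘ₗ f = LinearMap.id) (hB : IsWeaklyRegular B xs) : IsWeaklyRegular A xs := by
  induction xs generalizing A B with
  | nil => exact .nil R A
  | cons x xs ih =>
    rw [isWeaklyRegular_cons_iff] at hB ⊢
    have hmap : QuotSMulTop.map x g ∘ₗ QuotSMulTop.map x f = LinearMap.id := by
      rw [← QuotSMulTop.map_comp, hgf, QuotSMulTop.map_id]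
    exact ⟨hB.1.of_injective f (Function.LeftInverse.injective (LinearMap.congr_fun hgf)),
      ih hmap hB.2⟩

theorem isWeaklyRegular_of_subsingleton [Subsingleton M] (xs : List R) : IsWeaklyRegular M xs := by
  induction xs generalizing M with
  | nil => exact .nil R M
  | cons x xs ih =>
    have : Subsingleton (QuotSMulTop x M) := (Submodule.mkQ_surjective _).subsingleton
    exact .cons (Function.injective_of_subsingleton _) ih

theorem mem_pointwise_smul_top_iff {r : R} {m : M} :
    m ∈ (r • ⊤ : Submodule R M) ↔ ∃ a : M, r • a = m := by
  simp [Submodule.mem_smul_pointwise_iff_exists]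

variable (M) in
/-- Multiplication by `r` as a map `M/sM → M/rsM`. It continues the projection `M/rsM → M/rM` to
the left. -/
def quotSMulTopMul (r s : R) : QuotSMulTop s M →ₗ[R] QuotSMulTop (r * s) M :=
  Submodule.mapQ _ _ (LinearMap.lsmul R M r) fun a ha => by
    obtain ⟨b, rfl⟩ := mem_pointwise_smul_top_iff.1 ha
    exact mem_pointwise_smul_top_iff.2 ⟨b, mul_smul r s b⟩

variable (M) in
theorem smul_mul_top_le (r s : R) : ((r * s) • ⊤ : Submodule R M) ≤ r • ⊤ := fun _ ha => by
  obtain ⟨b, rfl⟩ := mem_pointwise_smul_top_iff.1 ha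
  exact mem_pointwise_smul_top_iff.2 ⟨s • b, (mul_smul r s b).symm⟩

theorem quotSMulTopMul_injective {r : R} (hr : IsSMulRegular M r) (s : R) :
    Function.Injective (quotSMulTopMul M r s) := by
  rw [injective_iff_map_eq_zero]
  intro a h
  obtain ⟨a, rfl⟩ := Submodule.mkQ_surjective _ a
  obtain ⟨b, hb⟩ := mem_pointwise_smul_top_iff.1 ((Submodule.Quotient.mk_eq_zero _).1 h)
  rw [mul_smul] at hb
  exact (Submodule.Quotient.mk_eq_zero _).2 (mem_pointwise_smul_top_iff.2 ⟨b, hr hb⟩)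

theorem quotSMulTopMul_exact (r s : R) :
    Function.Exact (quotSMulTopMul M r s) (Submodule.factor (smul_mul_top_le M r s)) := by
  intro a
  obtain ⟨a, rfl⟩ := Submodule.mkQ_surjective _ a
  constructor
  · intro h
    obtain ⟨b, hb⟩ := mem_pointwise_smul_top_iff.1 ((Submodule.Quotient.mk_eq_zero _).1 h)
    exact ⟨Submodule.Quotient.mk b, congrArg _ hb⟩
  · rintro ⟨b, hb⟩
    obtain ⟨b, rfl⟩ := Submodule.mkQ_surjective _ b
    rw [← hb]
    exact (Submodule.Quotient.mk_eq_zero _).2 (mem_pointwise_smul_top_iff.2 ⟨b, rfl⟩)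

theorem isWeaklyRegular_quotSMulTop_mul {r s : R} {xs : List R} (hr : IsSMulRegular M r)
    (hxr : IsWeaklyRegular (QuotSMulTop r M) xs) (hxs : IsWeaklyRegular (QuotSMulTop s M) xs) :
    IsWeaklyRegular (QuotSMulTop (r * s) M) xs :=
  isWeaklyRegular_of_exact (quotSMulTopMul_injective hr s) (quotSMulTopMul_exact r s)
    (Submodule.factor_surjective _) hxs hxr

theorem isWeaklyRegular_quotSMulTop_pow {x : R} {xs : List R} (hx : IsSMulRegular M x)
    (hxs : IsWeaklyRegular (QuotSMulTop x M) xs) (n : ℕ) :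
    IsWeaklyRegular (QuotSMulTop (x ^ n) M) xs := by
  induction n with
  | zero =>
    have : Subsingleton (QuotSMulTop (x ^ 0) M) := by
      rw [QuotSMulTop, Submodule.Quotient.subsingleton_iff, pow_zero, one_smul]
    exact isWeaklyRegular_of_subsingleton xs
  | succ n ih =>
    rw [pow_succ']
    exact isWeaklyRegular_quotSMulTop_mul hx hxs ih

theorem isWeaklyRegular_map_pow {xs : List R} (h : IsWeaklyRegular M xs) (n : ℕ) :
    IsWeaklyRegular M (xs.map (· ^ n)) := by
  induction xs generalizing M with
  | nil => exact h
  | cons x xs ih =>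
    rw [isWeaklyRegular_cons_iff] at h
    exact .cons (h.1.pow n) (ih (isWeaklyRegular_quotSMulTop_pow h.1 h.2 n))

theorem isSMulRegular_quotient_ofList_smul_top {x : R} {xs : List R} (hx : IsSMulRegular M x)
    (hxs : IsWeaklyRegular (QuotSMulTop x M) xs) :
    IsSMulRegular (M ⧸ (Ideal.ofList xs • ⊤ : Submodule R M)) x := by
  have hexact : Function.Exact (LinearMap.lsmul R M x) (x • ⊤ : Submodule R M).mkQ := fun a => by
    rw [Submodule.mkQ_apply, Submodule.Quotient.mk_eq_zero, mem_pointwise_smul_top_iff]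
    rfl
  have h := map_first_exact_on_four_term_right_exact_of_isSMulRegular_last
    ((LinearMap.exact_zero_iff_injective PUnit (LinearMap.lsmul R M x)).2 hx) hexact
    (Submodule.mkQ_surjective _) hxs
  rw [Submodule.mapQ_zero, LinearMap.exact_zero_iff_injective] at h
  refine fun a b hab => h ?_
  obtain ⟨a, rfl⟩ := Submodule.mkQ_surjective _ a
  obtain ⟨b, rfl⟩ := Submodule.mkQ_surjective _ b
  exact hab

theorem mkQ_mem_smul_top_iff (N : Submodule R M) (I : Ideal R) (m : M) :
    N.mkQ m ∈ (I • ⊤ : Submodule R (M ⧸ N)) ↔ m ∈ N ⊔ I • ⊤ := by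
  rw [← Submodule.comap_map_mkQ, Submodule.mem_comap, Submodule.map_smul'', Submodule.map_top,
    Submodule.range_mkQ]

theorem mem_ofList_smul_top_of_prod_pow_smul_mem {xs : List R} (h : IsWeaklyRegular M xs) (k : ℕ)
    {m : M} (hm : xs.prod ^ k • m ∈ (Ideal.ofList (xs.map (· ^ (k + 1))) • ⊤ : Submodule R M)) :
    m ∈ (Ideal.ofList xs • ⊤ : Submodule R M) := by
  induction xs generalizing M with
  | nil => simpa using hm
  | cons x xs ih =>
    rw [isWeaklyRegular_cons_iff] at h
    rw [List.map_cons, Ideal.ofList_cons_smul, List.prod_cons, mul_pow, mul_comm, mul_smul,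
      ← mkQ_mem_smul_top_iff, map_smul] at hm
    have hxm := ih (isWeaklyRegular_quotSMulTop_pow h.1 h.2 (k + 1)) hm
    rw [mkQ_mem_smul_top_iff] at hxm
    obtain ⟨_, ha, v, hv, hav⟩ := Submodule.mem_sup.1 hxm
    obtain ⟨m', rfl⟩ := mem_pointwise_smul_top_iff.1 ha
    have hdiff : m - x • m' ∈ (Ideal.ofList xs • ⊤ : Submodule R M) := by
      refine mem_of_isSMulRegular_quotient_of_smul_mem
        ((isSMulRegular_quotient_ofList_smul_top h.1 h.2).pow k) ?_
      rwa [smul_sub, ← hav, smul_smul, ← pow_succ, add_sub_cancel_left]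
    rw [Ideal.ofList_cons_smul]
    exact Submodule.mem_sup.2
      ⟨x • m', mem_pointwise_smul_top_iff.2 ⟨m', rfl⟩, _, hdiff, add_sub_cancel _ _⟩

end WeaklyRegular

/-! ### Homology in terms of elements -/

section Homology

open HomologicalComplex

variable {R : Type u} [CommRing R] {ι : Type*} {c : ComplexShape ι}

theorem exists_iCycles_eq (K : HomologicalComplex (ModuleCat.{v} R) c) {j k : ι}
    (hk : c.next j = k) {z : K.X j} (hz : K.d j k z = 0) :
    ∃ y : K.cycles j, K.iCycles j y = z := by
  let T := ShortComplex.mk (K.iCycles j) (K.d j k) (by simp)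
  have hT : T.Exact := T.exact_of_f_is_kernel (K.cyclesIsKernel j k hk)
  exact (ShortComplex.moduleCat_exact_iff T).1 hT z hz

theorem d_iCycles (K : HomologicalComplex (ModuleCat.{v} R) c) (j k : ι) (y : K.cycles j) :
    K.d j k (K.iCycles j y) = 0 := by
  rw [← ConcreteCategory.comp_apply, iCycles_d]
  rfl

theorem homologyπ_surjective (K : HomologicalComplex (ModuleCat.{v} R) c) (j : ι) :
    Function.Surjective (K.homologyπ j) :=
  (ModuleCat.epi_iff_surjective _).1 inferInstance

theorem homologyπ_eq_zero_iff (K : HomologicalComplex (ModuleCat.{v} R) c) {i j : ι}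
    (hi : c.prev j = i) (y : K.cycles j) :
    K.homologyπ j y = 0 ↔ ∃ w : K.X i, K.d i j w = K.iCycles j y := by
  let T := ShortComplex.mk (K.toCycles i j) (K.homologyπ j) (by simp)
  have hT : T.Exact := T.exact_of_g_is_cokernel (K.homologyIsCokernel i j hi)
  have hmono : Function.Injective (K.iCycles j) := (ModuleCat.mono_iff_injective _).1 inferInstance
  have hd (w : K.X i) : K.d i j w = K.iCycles j (K.toCycles i j w) := by
    rw [← ConcreteCategory.comp_apply, toCycles_i]
  simp only [hd, hmono.eq_iff]
  refine ⟨(ShortComplex.moduleCat_exact_iff T).1 hT y, ?_⟩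
  rintro ⟨w, rfl⟩
  rw [← ConcreteCategory.comp_apply, toCycles_comp_homologyπ]
  rfl

theorem homologyMap_eq_zero_iff {K L : HomologicalComplex (ModuleCat.{v} R) c} (φ : K ⟶ L)
    {i j k : ι} (hi : c.prev j = i) (hk : c.next j = k) :
    homologyMap φ j = 0 ↔ ∀ z : K.X j, K.d j k z = 0 → ∃ w : L.X i, L.d i j w = φ.f j z := by
  have hφ (y : K.cycles j) : homologyMap φ j (K.homologyπ j y) = 0 ↔
      ∃ w : L.X i, L.d i j w = φ.f j (K.iCycles j y) := by
    rw [← ConcreteCategory.comp_apply, homologyπ_naturality, ConcreteCategory.comp_apply,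
      homologyπ_eq_zero_iff L hi, ← ConcreteCategory.comp_apply (cyclesMap φ j), cyclesMap_i]
    rfl
  constructor
  · intro h z hz
    obtain ⟨y, rfl⟩ := exists_iCycles_eq K hk hz
    exact (hφ y).1 (by rw [h]; rfl)
  · intro h
    ext a
    obtain ⟨y, rfl⟩ := homologyπ_surjective K j a
    exact (hφ y).2 (h _ (d_iCycles K j k y))

theorem subsingleton_localizedModule_homology_iff (K : HomologicalComplex (ModuleCat.{v} R) c)
    {i j k : ι} (hi : c.prev j = i) (hk : c.next j = k) (S : Submonoid R) :
    Subsingleton (LocalizedModule S (K.homology j)) ↔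
      ∀ z : K.X j, K.d j k z = 0 → ∃ s ∈ S, ∃ w : K.X i, K.d i j w = s • z := by
  rw [LocalizedModule.subsingleton_iff]
  constructor
  · intro h z hz
    obtain ⟨y, rfl⟩ := exists_iCycles_eq K hk hz
    obtain ⟨s, hs, hsy⟩ := h (K.homologyπ j y)
    rw [← map_smul, homologyπ_eq_zero_iff K hi, map_smul] at hsy
    exact ⟨s, hs, hsy⟩
  · intro h a
    obtain ⟨y, rfl⟩ := homologyπ_surjective K j a
    obtain ⟨s, hs, hsy⟩ := h _ (d_iCycles K j k y)
    refine ⟨s, hs, ?_⟩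
    rwa [← map_smul, homologyπ_eq_zero_iff K hi, map_smul]

end Homology

/-! ### The total Koszul complex -/

section TotalKoszul

variable {R : Type u} [CommRing R] (M : Type v) [AddCommGroup M] [Module R M] {ℓ : ℕ}

/-- The differential of `⨁_i K_i(x, M)`. The underlying module consists of the families of elements
of `M` indexed by all subsets of `{1, …, ℓ}`, so that no index has to be transported along an
equality of cardinalities. -/
def koszulTotalD (x : Fin ℓ → R) : (Finset (Fin ℓ) → M) →ₗ[R] (Finset (Fin ℓ) → M) :=
  LinearMap.pi fun s => ∑ j ∈ sᶜ, (sgn R j s * x j) • LinearMap.proj (insert j s)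

/-- The map `⨁_i K_i(a, M) → ⨁_i K_i(b, M)` with components `koszulScale M c i`. -/
def koszulTotalScale (c : Fin ℓ → R) : (Finset (Fin ℓ) → M) →ₗ[R] (Finset (Fin ℓ) → M) :=
  LinearMap.pi fun s => (∏ j ∈ s, c j) • LinearMap.proj s

variable (R) in
/-- The inclusion of `K_i(x, M)` into `⨁_i K_i(x, M)`. -/
def koszulIncl (i : ℕ) : (Subsets ℓ i → M) →ₗ[R] (Finset (Fin ℓ) → M) :=
  LinearMap.pi fun s => if h : s.card = i then LinearMap.proj (⟨s, h⟩ : Subsets ℓ i) else 0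

/-- Multiplication by `c` sends the cycles of positive degree of `K_•(a, M)` to boundaries
of `K_•(b, M)`. When `c j * b j = a j`, this says that `koszulMap M` induces the zero map in
positive degrees. -/
def KoszulNull (a b c : Fin ℓ → R) : Prop :=
  ∀ F : Finset (Fin ℓ) → M, koszulTotalD M a F = 0 → F ∅ = 0 →
    ∃ G, koszulTotalD M b G = koszulTotalScale M c F

variable {M}

theorem koszulTotalD_apply (x : Fin ℓ → R) (F : Finset (Fin ℓ) → M) (s : Finset (Fin ℓ)) :
    koszulTotalD M x F s = ∑ j ∈ sᶜ, (sgn R j s * x j) • F (insert j s) := by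
  simp [koszulTotalD]

@[simp]
theorem koszulTotalScale_apply (c : Fin ℓ → R) (F : Finset (Fin ℓ) → M) (s : Finset (Fin ℓ)) :
    koszulTotalScale M c F s = (∏ j ∈ s, c j) • F s :=
  rfl

theorem koszulIncl_apply_of_card_eq {i : ℕ} (f : Subsets ℓ i → M) (s : Subsets ℓ i) :
    koszulIncl R M i f s.1 = f s := by
  simp [koszulIncl, s.2]

theorem koszulIncl_apply_of_card_ne {i : ℕ} (f : Subsets ℓ i → M) {s : Finset (Fin ℓ)}
    (hs : s.card ≠ i) : koszulIncl R M i f s = 0 := by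
  simp [koszulIncl, hs]

theorem sum_koszulIncl (F : Finset (Fin ℓ) → M) :
    ∑ i ∈ Finset.range (ℓ + 1), koszulIncl R M i (fun s => F s.1) = F := by
  ext s
  have hs : s.card ∈ Finset.range (ℓ + 1) := Finset.mem_range_succ_iff.2 (card_finset_fin_le s)
  rw [Finset.sum_apply, Finset.sum_eq_single_of_mem _ hs fun i _ hi =>
    koszulIncl_apply_of_card_ne _ hi.symm]
  exact koszulIncl_apply_of_card_eq (R := R) (fun t => F t.1) ⟨s, rfl⟩

theorem koszulD_restrict (x : Fin ℓ → R) (i : ℕ) (F : Finset (Fin ℓ) → M) :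
    koszulD M x i (fun t => F t.1) = fun s => koszulTotalD M x F s.1 := by
  ext s
  rw [koszulD_apply, koszulTotalD_apply, ← Finset.sum_subset (Finset.subset_univ s.1ᶜ)]
  · refine Finset.sum_congr rfl fun j hj => ?_
    rw [dif_neg (Finset.mem_compl.1 hj), smul_smul]
  · exact fun j _ hj => dif_pos (by simpa using hj)

theorem koszulTotalD_koszulIncl (x : Fin ℓ → R) (i : ℕ) (f : Subsets ℓ (i + 1) → M) :
    koszulTotalD M x (koszulIncl R M (i + 1) f) = koszulIncl R M i (koszulD M x i f) := by
  ext s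
  by_cases hs : s.card = i
  · have hf : (fun t : Subsets ℓ (i + 1) => koszulIncl R M (i + 1) f t.1) = f :=
      funext (koszulIncl_apply_of_card_eq f)
    rw [koszulIncl_apply_of_card_eq _ (⟨s, hs⟩ : Subsets ℓ i)]
    nth_rw 2 [← hf]
    rw [koszulD_restrict]
  · rw [koszulIncl_apply_of_card_ne _ hs, koszulTotalD_apply]
    refine Finset.sum_eq_zero fun j hj => ?_
    rw [koszulIncl_apply_of_card_ne, smul_zero]
    rwa [Finset.card_insert_of_notMem (Finset.mem_compl.1 hj), Ne, Nat.add_right_cancel_iff]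

theorem koszulTotalD_koszulTotalD (x : Fin ℓ → R) (F : Finset (Fin ℓ) → M) :
    koszulTotalD M x (koszulTotalD M x F) = 0 := by
  ext s
  have h := LinearMap.congr_fun (koszulD_comp M x s.card) fun t => F t.1
  rw [LinearMap.comp_apply, koszulD_restrict, koszulD_restrict] at h
  exact congrFun h ⟨s, rfl⟩

theorem koszulTotalD_koszulTotalScale {a b c : Fin ℓ → R} (h : ∀ j, c j * b j = a j)
    (F : Finset (Fin ℓ) → M) :
    koszulTotalD M b (koszulTotalScale M c F) = koszulTotalScale M c (koszulTotalD M a F) := by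
  ext s
  simp only [koszulTotalScale_apply, koszulTotalD_apply, Finset.smul_sum, smul_smul]
  refine Finset.sum_congr rfl fun j hj => ?_
  rw [Finset.prod_insert (Finset.mem_compl.1 hj), ← h j]
  congr 1
  ring

theorem koszulTotalScale_koszulTotalScale (c c' : Fin ℓ → R) (F : Finset (Fin ℓ) → M) :
    koszulTotalScale M c (koszulTotalScale M c' F) = koszulTotalScale M (c * c') F := by
  ext s
  simp [Finset.prod_mul_distrib, mul_smul]

theorem koszulTotalD_map {N : Type*} [AddCommGroup N] [Module R N] (f : M →ₗ[R] N)
    (x : Fin ℓ → R) (F : Finset (Fin ℓ) → M) :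
    koszulTotalD N x (f ∘ F) = f ∘ koszulTotalD M x F := by
  ext s
  simp [koszulTotalD_apply]

theorem koszulTotalScale_map {N : Type*} [AddCommGroup N] [Module R N] (f : M →ₗ[R] N)
    (c : Fin ℓ → R) (F : Finset (Fin ℓ) → M) :
    koszulTotalScale N c (f ∘ F) = f ∘ koszulTotalScale M c F := by
  ext s
  simp

theorem koszulTotalD_algebraMap {A : Type*} [CommRing A] [Algebra R A] [Module A M]
    [IsScalarTower R A M] (x : Fin ℓ → R) (F : Finset (Fin ℓ) → M) :
    koszulTotalD M (fun j => algebraMap R A (x j)) F = koszulTotalD M x F := by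
  ext s
  rw [koszulTotalD_apply, koszulTotalD_apply]
  refine Finset.sum_congr rfl fun j _ => ?_
  have hsgn : sgn A j s = algebraMap R A (sgn R j s) := by simp [sgn]
  rw [hsgn, ← map_mul, algebraMap_smul]

theorem koszulTotalScale_algebraMap {A : Type*} [CommRing A] [Algebra R A] [Module A M]
    [IsScalarTower R A M] (c : Fin ℓ → R) (F : Finset (Fin ℓ) → M) :
    koszulTotalScale M (fun j => algebraMap R A (c j)) F = koszulTotalScale M c F := by
  ext s
  rw [koszulTotalScale_apply, koszulTotalScale_apply, ← map_prod, algebraMap_smul]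

end TotalKoszul

section KoszulNull

variable {R : Type u} [CommRing R] {M : Type v} [AddCommGroup M] [Module R M] {ℓ : ℕ}

theorem KoszulNull.comp {a b c a' b' d e : Fin ℓ → R} (h : KoszulNull M a b c)
    (hd : ∀ j, d j * a j = a' j) (he : ∀ j, e j * b' j = b j) :
    KoszulNull M a' b' (e * (c * d)) := by
  intro F hF hF₀
  obtain ⟨G, hG⟩ := h (koszulTotalScale M d F)
    (by rw [koszulTotalD_koszulTotalScale hd, hF, map_zero])
    (by rw [koszulTotalScale_apply, hF₀, smul_zero])
  refine ⟨koszulTotalScale M e G, ?_⟩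
  rw [koszulTotalD_koszulTotalScale he, hG, koszulTotalScale_koszulTotalScale,
    koszulTotalScale_koszulTotalScale, mul_assoc]

theorem KoszulNull.of_retract {N : Type*} [AddCommGroup N] [Module R N] {a b c : Fin ℓ → R}
    {f : M →ₗ[R] N} {g : N →ₗ[R] M} (hgf : g ∘ₗ f = LinearMap.id) (h : KoszulNull N a b c) :
    KoszulNull M a b c := by
  intro F hF hF₀
  obtain ⟨G, hG⟩ := h (f ∘ F) (by rw [koszulTotalD_map, hF]; ext; simp) (by simp [hF₀])
  refine ⟨g ∘ G, ?_⟩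
  rw [koszulTotalD_map, hG, koszulTotalScale_map, ← Function.comp_assoc, ← LinearMap.coe_comp, hgf]
  rfl

theorem KoszulNull.prod {N : Type*} [AddCommGroup N] [Module R N] {a b c : Fin ℓ → R}
    (hM : KoszulNull M a b c) (hN : KoszulNull N a b c) : KoszulNull (M × N) a b c := by
  intro F hF hF₀
  obtain ⟨G, hG⟩ := hM (LinearMap.fst R M N ∘ F) (by rw [koszulTotalD_map, hF]; ext; simp)
    (by simp [hF₀])
  obtain ⟨G', hG'⟩ := hN (LinearMap.snd R M N ∘ F) (by rw [koszulTotalD_map, hF]; ext; simp)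
    (by simp [hF₀])
  refine ⟨fun s => (G s, G' s), funext fun s => Prod.ext ?_ ?_⟩
  · calc (koszulTotalD (M × N) b (fun s => (G s, G' s)) s).1
        = koszulTotalD M b G s := (congrFun (koszulTotalD_map (LinearMap.fst R M N) b _) s).symm
      _ = (koszulTotalScale (M × N) c F s).1 := congrFun hG s
  · calc (koszulTotalD (M × N) b (fun s => (G s, G' s)) s).2
        = koszulTotalD N b G' s := (congrFun (koszulTotalD_map (LinearMap.snd R M N) b _) s).symm
      _ = (koszulTotalScale (M × N) c F s).2 := congrFun hG' s

theorem koszulNull_algebraMap_iff {A : Type*} [CommRing A] [Algebra R A] [Module A M]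
    [IsScalarTower R A M] (a b c : Fin ℓ → R) :
    KoszulNull M (fun j => algebraMap R A (a j)) (fun j => algebraMap R A (b j))
      (fun j => algebraMap R A (c j)) ↔ KoszulNull M a b c := by
  simp only [KoszulNull, koszulTotalD_algebraMap, koszulTotalScale_algebraMap]

theorem koszulNull_pow_mono {x : Fin ℓ → R} {n m m' : ℕ} (hn : n ≤ m) (hm : m ≤ m')
    (h : KoszulNull M (fun j => x j ^ m) (fun j => x j ^ n) (fun j => x j ^ (m - n))) :
    KoszulNull M (fun j => x j ^ m') (fun j => x j ^ n) (fun j => x j ^ (m' - n)) := by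
  have hcomp := h.comp (d := fun j => x j ^ (m' - m)) (e := 1) (b' := fun j => x j ^ n)
    (fun j => pow_sub_mul_pow _ hm) fun j => one_mul _
  convert hcomp using 1
  ext j
  simp only [Pi.mul_apply, Pi.one_apply, one_mul, ← pow_add]
  congr 1
  omega

end KoszulNull

/-! ### Weakly proregular sequences -/

section WeaklyProregular

variable {R : Type u} [CommRing R] {M : Type v} [AddCommGroup M] [Module R M] {ℓ : ℕ}

theorem koszulComplex_d (x : Fin ℓ → R) (i : ℕ) :
    (koszulComplex M x).d (i + 1) i = ModuleCat.ofHom (koszulD M x i) :=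
  ChainComplex.of_d (fun i => ModuleCat.of R (Subsets ℓ i → M))
    (fun i => ModuleCat.ofHom (koszulD M x i)) i

theorem homologyMap_koszulMap_eq_zero_iff {a b c : Fin ℓ → R} (h : ∀ j, c j * b j = a j) (i : ℕ) :
    HomologicalComplex.homologyMap (koszulMap M h) (i + 1) = 0 ↔
      ∀ f : Subsets ℓ (i + 1) → M, koszulD M a i f = 0 →
        ∃ g : Subsets ℓ (i + 2) → M, koszulD M b (i + 1) g = koszulScale M c (i + 1) f := by
  rw [homologyMap_eq_zero_iff (koszulMap M h) (i := i + 2) (j := i + 1) (k := i) (by simp)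
    (by simp), koszulComplex_d, koszulComplex_d]
  rfl

theorem forall_homologyMap_koszulMap_eq_zero_iff {a b c : Fin ℓ → R} (h : ∀ j, c j * b j = a j) :
    (∀ i, 1 ≤ i → HomologicalComplex.homologyMap (koszulMap M h) i = 0) ↔
      KoszulNull M a b c := by
  constructor
  · intro H F hF hF₀
    have hex (i : ℕ) : ∃ g : Subsets ℓ (i + 1) → M,
        koszulD M b i g = fun s => koszulTotalScale M c F s.1 := by
      rcases i with _ | i
      · refine ⟨0, ?_⟩
        ext ⟨s, hs⟩
        obtain rfl := Finset.card_eq_zero.1 hs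
        simp [hF₀]
      · refine (homologyMap_koszulMap_eq_zero_iff h i).1 (H _ i.succ_pos) (fun s => F s.1) ?_
        rw [koszulD_restrict, hF]
        rfl
    choose g hg using hex
    refine ⟨∑ i ∈ Finset.range (ℓ + 1), koszulIncl R M (i + 1) (g i), ?_⟩
    simp only [map_sum, koszulTotalD_koszulIncl, hg, sum_koszulIncl]
  · rintro H (_ | i) hi
    · exact absurd hi (by omega)
    rw [homologyMap_koszulMap_eq_zero_iff]
    intro f hf
    obtain ⟨G, hG⟩ := H (koszulIncl R M (i + 1) f)
      (by rw [koszulTotalD_koszulIncl, hf, map_zero])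
      (koszulIncl_apply_of_card_ne f (Nat.succ_ne_zero i).symm)
    refine ⟨fun s => G s.1, ?_⟩
    rw [koszulD_restrict, hG]
    ext s
    rw [koszulTotalScale_apply, koszulIncl_apply_of_card_eq]
    rfl

theorem get_ofFn_iff {α : Type*} (P : ∀ {n : ℕ}, (Fin n → α) → Prop) (x : Fin ℓ → α) :
    P (List.ofFn x).get ↔ P x :=
  iff_of_eq (congrArg (fun q : Σ n, Fin n → α => P q.2) (List.equivSigmaTuple.right_inv ⟨ℓ, x⟩))

theorem isWeaklyProregular_ofFn_iff (x : Fin ℓ → R) :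
    IsWeaklyProregular M (List.ofFn x) ↔ ∀ n : ℕ, ∃ m, n ≤ m ∧
      KoszulNull M (fun j => x j ^ m) (fun j => x j ^ n) (fun j => x j ^ (m - n)) := by
  simp only [IsWeaklyProregular, koszulTransition, forall_homologyMap_koszulMap_eq_zero_iff,
    exists_prop]
  exact get_ofFn_iff (fun {_} x => ∀ n : ℕ, ∃ m, n ≤ m ∧
    KoszulNull M (fun j => x j ^ m) (fun j => x j ^ n) (fun j => x j ^ (m - n))) x

theorem exists_eq_ofFn {α : Type*} (x : List α) : ∃ (ℓ : ℕ) (y : Fin ℓ → α), x = List.ofFn y :=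
  ⟨_, x.get, (List.ofFn_get x).symm⟩

theorem isWeaklyProregular_of_retract {N : Type*} [AddCommGroup N] [Module R N] {f : M →ₗ[R] N}
    {g : N →ₗ[R] M} (hgf : g ∘ₗ f = LinearMap.id) {x : List R} (h : IsWeaklyProregular N x) :
    IsWeaklyProregular M x := by
  obtain ⟨ℓ, x, rfl⟩ := exists_eq_ofFn x
  rw [isWeaklyProregular_ofFn_iff] at h ⊢
  intro n
  obtain ⟨m, hnm, hm⟩ := h n
  exact ⟨m, hnm, hm.of_retract hgf⟩

theorem isWeaklyProregular_prod_iff {N : Type*} [AddCommGroup N] [Module R N] {x : List R} :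
    IsWeaklyProregular (M × N) x ↔ IsWeaklyProregular M x ∧ IsWeaklyProregular N x := by
  refine ⟨fun h => ⟨isWeaklyProregular_of_retract (LinearMap.fst_comp_inl R M N) h,
    isWeaklyProregular_of_retract (LinearMap.snd_comp_inr R M N) h⟩, ?_⟩
  obtain ⟨ℓ, x, rfl⟩ := exists_eq_ofFn x
  simp only [isWeaklyProregular_ofFn_iff]
  intro ⟨hM, hN⟩ n
  obtain ⟨m, hnm, hm⟩ := hM n
  obtain ⟨m', hnm', hm'⟩ := hN n
  exact ⟨max m m', le_max_of_le_left hnm, (koszulNull_pow_mono hnm (le_max_left _ _) hm).prod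
    (koszulNull_pow_mono hnm' (le_max_right _ _) hm')⟩

theorem isWeaklyProregular_map_algebraMap_iff {A : Type*} [CommRing A] [Algebra R A] [Module A M]
    [IsScalarTower R A M] {x : List R} :
    IsWeaklyProregular M (x.map (algebraMap R A)) ↔ IsWeaklyProregular M x := by
  obtain ⟨ℓ, x, rfl⟩ := exists_eq_ofFn x
  simp only [List.map_ofFn, isWeaklyProregular_ofFn_iff, Function.comp_apply, ← map_pow,
    koszulNull_algebraMap_iff]

theorem isWeaklyProregular_ofFn_of_dvd_pow {w z : Fin ℓ → R} {p q : ℕ}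
    (hzw : ∀ j, z j ∣ w j ^ p) (hwz : ∀ j, w j ∣ z j ^ q)
    (h : IsWeaklyProregular M (List.ofFn w)) : IsWeaklyProregular M (List.ofFn z) := by
  choose e he using hzw
  choose d hd using hwz
  rw [isWeaklyProregular_ofFn_iff] at h ⊢
  intro n
  obtain ⟨m, hnm, hm⟩ := h (p * n)
  have hcomp := hm.comp (a' := fun j => z j ^ (q * m + n)) (b' := fun j => z j ^ n)
    (d := fun j => z j ^ n * d j ^ m) (e := fun j => e j ^ n)
    (fun j => by rw [pow_add, pow_mul, hd]; ring)
    (fun j => by rw [pow_mul, he]; ring)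
  refine ⟨q * m + n, Nat.le_add_left _ _, ?_⟩
  convert hcomp using 1
  ext j
  calc z j ^ (q * m + n - n) = w j ^ m * d j ^ m := by
        rw [Nat.add_sub_cancel, pow_mul, hd, mul_pow]
    _ = (w j ^ (m - p * n) * w j ^ (p * n)) * d j ^ m := by rw [pow_sub_mul_pow _ hnm]
    _ = e j ^ n * (w j ^ (m - p * n) * (z j ^ n * d j ^ m)) := by rw [pow_mul, he]; ring

end WeaklyProregular

/-! ### Acyclicity of the Koszul complex of a regular sequence -/

section Acyclic

open RingTheory.Sequence Pointwise

variable {R : Type u} [CommRing R] {M : Type v} [AddCommGroup M] [Module R M] {ℓ : ℕ}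

/-- The shift of a subset of `{1, …, ℓ}` to `{2, …, ℓ + 1}`. -/
abbrev shift (s : Finset (Fin ℓ)) : Finset (Fin (ℓ + 1)) := s.map (Fin.succEmb ℓ)

/-- The subset of those `j` for which `j + 1` lies in `t`; the element `1` of `t` is forgotten. -/
def unshift (t : Finset (Fin (ℓ + 1))) : Finset (Fin ℓ) := {j | j.succ ∈ t}

theorem unshift_shift (s : Finset (Fin ℓ)) : unshift (shift s) = s := by
  ext j; simp [unshift]

theorem unshift_insert_zero (t : Finset (Fin (ℓ + 1))) : unshift (insert 0 t) = unshift t := by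
  ext j; simp [unshift, Fin.succ_ne_zero]

theorem zero_notMem_shift (s : Finset (Fin ℓ)) : 0 ∉ shift s := by
  simp [Fin.succ_ne_zero]

theorem eq_shift_or_eq_insert_shift (t : Finset (Fin (ℓ + 1))) :
    ∃ s : Finset (Fin ℓ), t = shift s ∨ t = insert 0 (shift s) := by
  refine ⟨unshift t, ?_⟩
  by_cases h : 0 ∈ t
  · right
    ext j
    cases j using Fin.cases <;> simp [unshift, h, Fin.succ_ne_zero]
  · left
    ext j
    cases j using Fin.cases <;> simp [unshift, h, Fin.succ_ne_zero]

theorem compl_shift (s : Finset (Fin ℓ)) : (shift s)ᶜ = insert 0 (shift sᶜ) := by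
  ext j
  cases j using Fin.cases <;> simp [Fin.succ_ne_zero]

theorem compl_insert_zero_shift (s : Finset (Fin ℓ)) : (insert 0 (shift s))ᶜ = shift sᶜ := by
  rw [Finset.compl_insert, compl_shift, Finset.erase_insert (zero_notMem_shift _)]

theorem insert_succ_shift (j : Fin ℓ) (s : Finset (Fin ℓ)) :
    insert j.succ (shift s) = shift (insert j s) := by
  simp [shift, Finset.map_insert]

theorem sgn_succ_shift (j : Fin ℓ) (s : Finset (Fin ℓ)) : sgn R j.succ (shift s) = sgn R j s := by
  unfold sgn
  rw [Finset.filter_map, Finset.card_map]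
  congr 3
  ext k
  simp

theorem sgn_zero (s : Finset (Fin (ℓ + 1))) : sgn R 0 s = 1 := by
  simp [sgn]

/-- The element of `⨁_i K_i(x, M)` with components `c` outside `e_1` and `e` along `e_1`, for `x` of
length `ℓ + 1`. It exhibits `K_•(x, M)` as the cone of multiplication by `x_1` on
`K_•(x_2, …, x_{ℓ + 1}, M)`. -/
def koszulCons {α : Type*} (c e : Finset (Fin ℓ) → α) (t : Finset (Fin (ℓ + 1))) : α :=
  if 0 ∈ t then e (unshift t) else c (unshift t)

@[simp]
theorem koszulCons_shift {α : Type*} (c e : Finset (Fin ℓ) → α) (s : Finset (Fin ℓ)) :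
    koszulCons c e (shift s) = c s := by
  rw [koszulCons, if_neg (zero_notMem_shift s), unshift_shift]

@[simp]
theorem koszulCons_insert_shift {α : Type*} (c e : Finset (Fin ℓ) → α) (s : Finset (Fin ℓ)) :
    koszulCons c e (insert 0 (shift s)) = e s := by
  rw [koszulCons, if_pos (Finset.mem_insert_self _ _), unshift_insert_zero, unshift_shift]

theorem exists_eq_koszulCons {α : Type*} (F : Finset (Fin (ℓ + 1)) → α) :
    ∃ c e : Finset (Fin ℓ) → α, F = koszulCons c e := by
  refine ⟨fun s => F (shift s), fun s => F (insert 0 (shift s)), funext fun t => ?_⟩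
  obtain ⟨s, rfl | rfl⟩ := eq_shift_or_eq_insert_shift t
  · rw [koszulCons_shift]
  · rw [koszulCons_insert_shift]

theorem koszulCons_eq_zero_iff {c e : Finset (Fin ℓ) → M} :
    koszulCons c e = 0 ↔ c = 0 ∧ e = 0 := by
  refine ⟨fun h => ⟨funext fun s => ?_, funext fun s => ?_⟩, fun ⟨hc, he⟩ => ?_⟩
  · simpa using congrFun h (shift s)
  · simpa using congrFun h (insert 0 (shift s))
  · ext t
    simp [koszulCons, hc, he]

theorem koszulTotalD_koszulCons (x : Fin (ℓ + 1) → R) (c e : Finset (Fin ℓ) → M) :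
    koszulTotalD M x (koszulCons c e) =
      koszulCons (x 0 • e + koszulTotalD M (fun j => x j.succ) c)
        (-koszulTotalD M (fun j => x j.succ) e) := by
  ext t
  obtain ⟨s, rfl | rfl⟩ := eq_shift_or_eq_insert_shift t
  · rw [koszulCons_shift, koszulTotalD_apply, compl_shift,
      Finset.sum_insert (zero_notMem_shift _), Finset.sum_map, sgn_zero, one_mul,
      koszulCons_insert_shift]
    simp only [Fin.coe_succEmb, sgn_succ_shift, insert_succ_shift, koszulCons_shift,
      Pi.add_apply, Pi.smul_apply, koszulTotalD_apply]
  · rw [koszulCons_insert_shift, koszulTotalD_apply, compl_insert_zero_shift, Finset.sum_map]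
    simp only [Fin.coe_succEmb, sgn_insert R (zero_notMem_shift s), if_pos (Fin.succ_pos _),
      sgn_succ_shift, Finset.insert_comm (Fin.succ _) 0, insert_succ_shift, koszulCons_insert_shift,
      neg_mul, neg_smul, Finset.sum_neg_distrib, Pi.neg_apply, koszulTotalD_apply]

theorem exists_smul_add_koszulTotalD_eq (r : R) (x : Fin ℓ → R) {c : Finset (Fin ℓ) → M}
    {g' : Finset (Fin ℓ) → QuotSMulTop r M}
    (h : koszulTotalD _ x g' = (r • ⊤ : Submodule R M).mkQ ∘ c) :
    ∃ e g : Finset (Fin ℓ) → M, r • e + koszulTotalD M x g = c := by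
  choose g hg using fun s => Submodule.mkQ_surjective _ (g' s)
  obtain rfl : (r • ⊤ : Submodule R M).mkQ ∘ g = g' := funext hg
  rw [koszulTotalD_map] at h
  choose e he using fun s => mem_pointwise_smul_top_iff.1
    ((Submodule.Quotient.eq _).1 (congrFun h s).symm)
  exact ⟨e, g, funext fun s => eq_sub_iff_add_eq.1 (he s)⟩

theorem exists_koszulTotalD_eq {x : Fin ℓ → R} (hx : IsWeaklyRegular M (List.ofFn x))
    {F : Finset (Fin ℓ) → M} (hF : koszulTotalD M x F = 0) (hF₀ : F ∅ = 0) :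
    ∃ G, koszulTotalD M x G = F := by
  induction ℓ generalizing M with
  | zero =>
    refine ⟨0, ?_⟩
    ext s
    rw [Finset.eq_empty_of_isEmpty s, hF₀, map_zero]
    rfl
  | succ ℓ ih =>
    rw [List.ofFn_succ, isWeaklyRegular_cons_iff] at hx
    obtain ⟨c, e, rfl⟩ := exists_eq_koszulCons F
    rw [koszulTotalD_koszulCons, koszulCons_eq_zero_iff, neg_eq_zero] at hF
    have hc : koszulTotalD M (fun j => x j.succ) c = -(x 0 • e) := eq_neg_of_add_eq_zero_right hF.1
    have hcycle : koszulTotalD _ (fun j => x j.succ) ((x 0 • ⊤ : Submodule R M).mkQ ∘ c) = 0 := by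
      rw [koszulTotalD_map, hc]
      ext s
      exact (Submodule.Quotient.mk_eq_zero _).2
        (neg_mem (mem_pointwise_smul_top_iff.2 ⟨e s, rfl⟩))
    have hc₀ : c ∅ = 0 := by simpa [koszulCons, unshift] using hF₀
    obtain ⟨g', hg'⟩ := ih hx.2 hcycle (by rw [Function.comp_apply, hc₀, map_zero])
    obtain ⟨h, g, hgh⟩ := exists_smul_add_koszulTotalD_eq (x 0) _ hg'
    have hboundary : x 0 • -koszulTotalD M (fun j => x j.succ) h = x 0 • e := by
      rw [smul_neg, ← map_smul, eq_sub_of_add_eq hgh, map_sub, koszulTotalD_koszulTotalD, sub_zero,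
        hc, neg_neg]
    refine ⟨koszulCons g h, ?_⟩
    rw [koszulTotalD_koszulCons, hgh]
    congr 1
    exact funext fun s => hx.1 (congrFun hboundary s)

theorem isWeaklyProregular_of_isWeaklyRegular {x : List R} (hx : IsWeaklyRegular M x) :
    IsWeaklyProregular M x := by
  obtain ⟨ℓ, x, rfl⟩ := exists_eq_ofFn x
  refine (isWeaklyProregular_ofFn_iff x).2 fun n => ⟨n, le_rfl, fun F hF hF₀ => ?_⟩
  have hpow : IsWeaklyRegular M (List.ofFn fun j => x j ^ n) := by
    have h := isWeaklyRegular_map_pow hx n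
    rwa [List.map_ofFn] at h
  obtain ⟨G, hG⟩ := exists_koszulTotalD_eq hpow hF hF₀
  exact ⟨G, hG.trans (by ext s; simp)⟩

end Acyclic

/-! ### Top Čech cohomology -/

section TopCech

section Module

variable {A : Type u} [CommRing A] {M : Type v} [AddCommGroup M] [Module A M] {ℓ : ℕ}

variable (M) in
theorem cechComplex_d (x : Fin ℓ → A) (i : ℕ) :
    (cechComplex M x).d i (i + 1) = ModuleCat.ofHom (cechD M x i) :=
  CochainComplex.of_d (fun i => ModuleCat.of A ((s : Subsets ℓ i) → CechLoc M x s.1))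
    (fun i => ModuleCat.ofHom (cechD M x i)) i

variable (M) in
/-- The localization map `M → M_{∏ j ∈ t, x j}`. -/
abbrev toCechLoc (x : Fin ℓ → A) (t : Finset (Fin ℓ)) : M →ₗ[A] CechLoc M x t :=
  LocalizedModule.mkLinearMap _ M

theorem cechRes_toCechLoc (x : Fin ℓ → A) {s t : Finset (Fin ℓ)} (h : s ⊆ t) (m : M) :
    cechRes M x h (toCechLoc M x s m) = toCechLoc M x t m :=
  LinearMap.congr_fun (LocalizedModule.lift_comp _ _ (isUnit_cechLoc M x h)) m

theorem bijective_pow_smul_cechLoc (x : Fin ℓ → A) (t : Finset (Fin ℓ)) (n : ℕ) :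
    Function.Bijective fun v : CechLoc M x t => (∏ j ∈ t, x j) ^ n • v :=
  (Module.End.isUnit_iff _).1 (isUnit_cechLoc M x subset_rfl ⟨_, n, rfl⟩)

theorem exists_pow_smul_eq_toCechLoc (x : Fin ℓ → A) {t : Finset (Fin ℓ)} (v : CechLoc M x t) :
    ∃ (n : ℕ) (m : M), (∏ j ∈ t, x j) ^ n • v = toCechLoc M x t m := by
  obtain ⟨⟨m, ⟨_, n, rfl⟩⟩, h⟩ := IsLocalizedModule.surj (Submonoid.powers (∏ j ∈ t, x j))
    (toCechLoc M x t) v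
  exact ⟨n, m, h⟩

theorem toCechLoc_eq_iff (x : Fin ℓ → A) (t : Finset (Fin ℓ)) (m m' : M) :
    toCechLoc M x t m = toCechLoc M x t m' ↔
      ∃ n : ℕ, (∏ j ∈ t, x j) ^ n • m = (∏ j ∈ t, x j) ^ n • m' := by
  rw [IsLocalizedModule.eq_iff_exists (Submonoid.powers (∏ j ∈ t, x j))]
  exact ⟨fun ⟨⟨_, n, hn⟩, h⟩ => ⟨n, by subst hn; exact h⟩, fun ⟨n, h⟩ => ⟨⟨_, n, rfl⟩, h⟩⟩

theorem pow_smul_cechRes_erase (x : Fin ℓ → A) {t : Finset (Fin ℓ)} {j : Fin ℓ} (hj : j ∈ t)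
    {n : ℕ} {m : M} {v : CechLoc M x (t.erase j)}
    (hv : (∏ i ∈ t.erase j, x i) ^ n • v = toCechLoc M x (t.erase j) m) :
    (∏ i ∈ t, x i) ^ n • cechRes M x (t.erase_subset j) v = toCechLoc M x t (x j ^ n • m) := by
  have hprod : (∏ i ∈ t, x i) ^ n = x j ^ n * (∏ i ∈ t.erase j, x i) ^ n := by
    rw [← Finset.mul_prod_erase t x hj, mul_pow]
  rw [hprod, mul_smul, ← map_smul, hv, cechRes_toCechLoc, map_smul]

/-- The whole set `{1, …, ℓ}`. -/
abbrev topSubset (ℓ : ℕ) : Subsets ℓ ℓ := ⟨Finset.univ, Finset.card_fin ℓ⟩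

/-- The complement of a point of `{1, …, ℓ + 1}`. -/
abbrev coface (j : Fin (ℓ + 1)) : Subsets (ℓ + 1) ℓ :=
  ⟨Finset.univ.erase j, by rw [Finset.card_erase_of_mem (Finset.mem_univ j), Finset.card_fin]; rfl⟩

theorem eq_topSubset (t : Subsets ℓ ℓ) : t = topSubset ℓ :=
  Subtype.ext ((Finset.card_eq_iff_eq_univ _).1 (by simp [t.2]))

theorem isEmpty_subsets_succ : IsEmpty (Subsets ℓ (ℓ + 1)) :=
  ⟨fun t => (card_finset_fin_le t.1).not_gt (by simp [t.2])⟩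

theorem pow_smul_cechD_top (x : Fin (ℓ + 1) → A) {b : (s : Subsets (ℓ + 1) ℓ) → CechLoc M x s.1}
    {n : ℕ} {m : Fin (ℓ + 1) → M} (hb : ∀ j, (∏ i ∈ Finset.univ.erase j, x i) ^ n •
      b (coface j) = toCechLoc M x (Finset.univ.erase j) (m j)) :
    (∏ i, x i) ^ n • cechD M x ℓ b (topSubset _) =
      toCechLoc M x Finset.univ (∑ j, x j ^ n • sgn A j Finset.univ • m j) := by
  rw [cechD_apply, Finset.smul_sum, map_sum]
  refine Finset.sum_congr rfl fun j _ => ?_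
  rw [dif_pos (Finset.mem_univ j), smul_comm, pow_smul_cechRes_erase x (Finset.mem_univ j) (hb j),
    ← map_smul, smul_comm]

theorem sgn_mul_self (j : Fin ℓ) (s : Finset (Fin ℓ)) : sgn A j s * sgn A j s = 1 := by
  rw [sgn, ← mul_pow]
  simp

theorem exists_cechD_top_eq_iff (x : Fin (ℓ + 1) → A) (v : CechLoc M x Finset.univ) :
    (∃ b, cechD M x ℓ b (topSubset _) = v) ↔ ∃ (n : ℕ) (m : Fin (ℓ + 1) → M),
      (∏ j, x j) ^ n • v = toCechLoc M x Finset.univ (∑ j, x j ^ n • m j) := by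
  constructor
  · rintro ⟨b, rfl⟩
    choose k m hm using fun j : Fin (ℓ + 1) => exists_pow_smul_eq_toCechLoc x (b (coface j))
    have hk (j : Fin (ℓ + 1)) : k j ≤ ∑ j, k j :=
      Finset.single_le_sum (f := k) (fun _ _ => Nat.zero_le _) (Finset.mem_univ j)
    refine ⟨∑ j, k j, _, pow_smul_cechD_top x
      (m := fun j => (∏ i ∈ Finset.univ.erase j, x i) ^ (∑ j, k j - k j) • m j) fun j => ?_⟩
    rw [map_smul, ← hm, smul_smul, pow_sub_mul_pow _ (hk j)]
  · rintro ⟨n, m, hm⟩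
    choose b hb using fun s : Subsets (ℓ + 1) ℓ => (bijective_pow_smul_cechLoc x s.1 n).2
      (toCechLoc M x s.1 (∑ j ∈ s.1ᶜ, sgn A j Finset.univ • m j))
    have hbj (j : Fin (ℓ + 1)) : (∏ i ∈ Finset.univ.erase j, x i) ^ n • b (coface j) =
        toCechLoc M x (Finset.univ.erase j) (sgn A j Finset.univ • m j) := by
      simpa using hb (coface j)
    refine ⟨b, (bijective_pow_smul_cechLoc x Finset.univ n).1 ?_⟩
    simp only [pow_smul_cechD_top x hbj, hm, smul_smul, sgn_mul_self, one_smul]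

theorem subsingleton_localizedModule_cech_iff (x : Fin (ℓ + 1) → A) (S : Submonoid A) :
    Subsingleton (LocalizedModule S ((cechComplex M x).homology (ℓ + 1))) ↔
      ∀ v : CechLoc M x Finset.univ, ∃ s ∈ S, ∃ (n : ℕ) (m : Fin (ℓ + 1) → M),
        (∏ j, x j) ^ n • s • v = toCechLoc M x Finset.univ (∑ j, x j ^ n • m j) := by
  have hd (z : (t : Subsets (ℓ + 1) (ℓ + 1)) → CechLoc M x t.1) : cechD M x (ℓ + 1) z = 0 :=
    funext fun t => isEmpty_subsets_succ.elim t
  rw [subsingleton_localizedModule_homology_iff (cechComplex M x) (i := ℓ) (j := ℓ + 1)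
    (k := ℓ + 2) (by simp) (by simp)]
  simp only [← exists_cechD_top_eq_iff, cechComplex_d]
  constructor
  · intro h v
    obtain ⟨s, hs, b, hb⟩ := h (fun t => by rw [eq_topSubset t]; exact v) (hd _)
    exact ⟨s, hs, b, congrFun hb (topSubset _)⟩
  · intro h z _
    obtain ⟨s, hs, b, hb⟩ := h (z (topSubset _))
    refine ⟨s, hs, b, funext fun t => ?_⟩
    rw [eq_topSubset t]
    exact hb

end Module

section Ring

variable {A : Type u} [CommRing A] {ℓ : ℕ}

theorem ofList_ofFn (x : Fin ℓ → A) : Ideal.ofList (List.ofFn x) = Ideal.span (Set.range x) :=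
  congrArg Ideal.span (Set.ext fun _ => List.mem_ofFn)

theorem mul_prod_mem_span_range {a b c : Fin ℓ → A} (h : ∀ j, b j ∣ a j * c j) {r : A}
    (hr : r ∈ Ideal.span (Set.range a)) : r * ∏ j, c j ∈ Ideal.span (Set.range b) := by
  obtain ⟨d, rfl⟩ := Ideal.mem_span_range_iff_exists_fun.1 hr
  rw [Finset.sum_mul]
  refine sum_mem fun j _ => Ideal.mem_of_dvd _ ?_ (Ideal.subset_span ⟨j, rfl⟩)
  rw [← Finset.mul_prod_erase _ c (Finset.mem_univ j), mul_assoc, ← mul_assoc (a j)]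
  exact ((h j).mul_right _).mul_left _

/-- An elementary form of the vanishing of the localization of `H^ℓ_x(A)` at `S`: it says that in
`H^ℓ_x(A)`, the direct limit of the modules `A / (x_1 ^ n, …, x_ℓ ^ n)` along multiplication
by `x_1 ⋯ x_ℓ`, the image of `1` at each stage is killed by an element of `S`. -/
def TopCechVanishes (x : List A) (S : Submonoid A) : Prop :=
  ∀ n : ℕ, ∃ s ∈ S, ∃ k : ℕ, s * x.prod ^ k ∈ Ideal.ofList (x.map (· ^ (n + k)))

theorem topCechVanishes_ofFn_iff {x : Fin ℓ → A} {S : Submonoid A} :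
    TopCechVanishes (List.ofFn x) S ↔ ∀ n : ℕ, ∃ s ∈ S, ∃ k : ℕ,
      s * (∏ j, x j) ^ k ∈ Ideal.span (Set.range fun j => x j ^ (n + k)) := by
  simp only [TopCechVanishes, List.prod_ofFn, List.map_ofFn, ofList_ofFn]
  rfl

theorem TopCechVanishes.map {B : Type*} [CommRing B] {x : List A} {S : Submonoid A}
    {T : Submonoid B} (f : A →+* B) (hf : S ≤ T.comap f) (h : TopCechVanishes x S) :
    TopCechVanishes (x.map f) T := by
  intro n
  obtain ⟨s, hs, k, hk⟩ := h n
  refine ⟨f s, hf hs, k, ?_⟩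
  have hmem := Ideal.mem_map_of_mem f hk
  rw [map_mul, map_pow, map_list_prod, Ideal.map_ofList, List.map_map] at hmem
  rw [List.map_map]
  convert hmem using 3
  ext a
  simp

theorem topCechVanishes_ofFn_of_dvd_pow {w z : Fin ℓ → A} {p q : ℕ}
    (hzw : ∀ j, z j ∣ w j ^ p) (hwz : ∀ j, w j ∣ z j ^ q) {S : Submonoid A}
    (h : TopCechVanishes (List.ofFn z) S) : TopCechVanishes (List.ofFn w) S := by
  choose e he using hzw
  rw [topCechVanishes_ofFn_iff] at h ⊢
  intro n
  obtain ⟨s, hs, k, hk⟩ := h (q * n)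
  refine ⟨s, hs, p * k, ?_⟩
  have hprod : s * (∏ j, w j) ^ (p * k) = s * (∏ j, z j) ^ k * ∏ j, e j ^ k := by
    simp only [pow_mul, ← Finset.prod_pow, he, mul_pow, Finset.prod_mul_distrib, mul_assoc]
  rw [hprod]
  refine mul_prod_mem_span_range (fun j => ?_) hk
  calc w j ^ (n + p * k) = w j ^ n * (w j ^ p) ^ k := by rw [pow_add, pow_mul]
    _ ∣ (z j ^ q) ^ n * (w j ^ p) ^ k := mul_dvd_mul_right (pow_dvd_pow_of_dvd (hwz j) n) _
    _ = z j ^ (q * n + k) * e j ^ k := by rw [he, mul_pow, pow_add, pow_mul, mul_assoc]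

theorem subsingleton_localizedModule_cech_iff_topCechVanishes (x : Fin (ℓ + 1) → A)
    (S : Submonoid A) : Subsingleton (LocalizedModule S ((cechComplex A x).homology (ℓ + 1))) ↔
      TopCechVanishes (List.ofFn x) S := by
  rw [subsingleton_localizedModule_cech_iff, topCechVanishes_ofFn_iff]
  constructor
  · intro h n
    obtain ⟨v, hv : (∏ j, x j) ^ n • v = _⟩ :=
      (bijective_pow_smul_cechLoc x Finset.univ n).2 (toCechLoc A x Finset.univ 1)
    obtain ⟨s, hs, N, a, ha⟩ := h v
    have hsum : toCechLoc A x Finset.univ (s * (∏ j, x j) ^ N) =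
        toCechLoc A x Finset.univ ((∏ j, x j) ^ n * ∑ j, x j ^ N * a j) := by
      rw [← smul_eq_mul (_ ^ n), map_smul]
      simp only [← smul_eq_mul (x _ ^ N)]
      rw [← ha, smul_comm _ s, smul_comm _ s, smul_comm _ (_ ^ N), hv, smul_smul, ← map_smul,
        smul_eq_mul, mul_one]
    obtain ⟨t, ht⟩ := (toCechLoc_eq_iff x _ _ _).1 hsum
    refine ⟨s, hs, N + t, ?_⟩
    have hmem : (∑ j, x j ^ N * a j) * ∏ j, x j ^ (n + t) ∈
        Ideal.span (Set.range fun j => x j ^ (n + (N + t))) :=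
      mul_prod_mem_span_range (a := fun j => x j ^ N) (fun j => dvd_of_eq (by ring))
        (Ideal.mem_span_range_iff_exists_fun.2 ⟨a, by simp only [mul_comm]⟩)
    convert hmem using 1
    rw [Finset.prod_pow]
    simp only [smul_eq_mul] at ht
    linear_combination ht
  · intro h v
    obtain ⟨n, c, hc⟩ := exists_pow_smul_eq_toCechLoc x v
    obtain ⟨s, hs, k, hk⟩ := h n
    obtain ⟨a, ha⟩ := Ideal.mem_span_range_iff_exists_fun.1 hk
    refine ⟨s, hs, n + k, fun j => c * a j, ?_⟩
    rw [smul_comm, add_comm n k, pow_add, mul_smul, hc, smul_smul, ← map_smul, ← ha]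
    congr 1
    simp only [smul_eq_mul, Finset.sum_mul]
    exact Finset.sum_congr rfl fun j _ => by ring

theorem nontrivial_localizedModule_cech_iff {x : List A} (hx : x ≠ []) (S : Submonoid A) :
    Nontrivial (LocalizedModule S (cechCohomology A x x.length)) ↔ ¬ TopCechVanishes x S := by
  rw [← not_subsingleton_iff_nontrivial, not_iff_not]
  cases x with
  | nil => exact absurd rfl hx
  | cons a x =>
    have h := subsingleton_localizedModule_cech_iff_topCechVanishes (a :: x).get S
    rwa [List.ofFn_get] at h

theorem mem_support_quotient_ofList_iff (x : List A) (p : PrimeSpectrum A) :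
    p ∈ Module.support A (A ⧸ (Ideal.ofList x • (⊤ : Submodule A A))) ↔
      Ideal.ofList x ≤ p.asIdeal := by
  rw [smul_eq_mul, Ideal.mul_top, Module.support_eq_zeroLocus, Ideal.annihilator_quotient,
    PrimeSpectrum.mem_zeroLocus, SetLike.coe_subset_coe]

theorem isParameterSequence_iff {x : List A} (hx : x ≠ []) :
    IsParameterSequence A x ↔ IsWeaklyProregular A x ∧ Ideal.ofList x ≠ ⊤ ∧
      ∀ p : PrimeSpectrum A, Ideal.ofList x ≤ p.asIdeal →
        ¬ TopCechVanishes x p.asIdeal.primeCompl := by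
  simp only [← nontrivial_localizedModule_cech_iff hx, ← mem_support_quotient_ofList_iff]
  have htop : Ideal.ofList x • (⊤ : Submodule A A) = Ideal.ofList x := Ideal.mul_top _
  exact ⟨fun ⟨h₁, h₂, h₃⟩ => ⟨h₁, htop ▸ h₂, h₃⟩, fun ⟨h₁, h₂, h₃⟩ => ⟨h₁, htop.symm ▸ h₂, h₃⟩⟩

end Ring

end TopCech

/-! ### Regular sequences are strong parameter sequences -/

section StrongParameter

open RingTheory.Sequence

variable {A : Type u} [CommRing A] {x : List A}

theorem IsStrongParameterSequence.isParameterSequence {M : Type v} [AddCommGroup M] [Module A M]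
    (h : IsStrongParameterSequence M x) (hx : x ≠ []) : IsParameterSequence M x := by
  simpa using h x.length (List.length_pos_iff.2 hx) le_rfl

theorem IsStrongParameterSequence.isWeaklyProregular {M : Type v} [AddCommGroup M] [Module A M]
    (h : IsStrongParameterSequence M x) : IsWeaklyProregular M x := by
  rcases eq_or_ne x [] with rfl | hx
  · exact isWeaklyProregular_of_isWeaklyRegular (.nil A M)
  · exact (h.isParameterSequence hx).weaklyProregular

theorem isStrongParameterSequence_iff {M : Type v} [AddCommGroup M] [Module A M] :
    IsStrongParameterSequence M x ↔ ∀ i, x.take i ≠ [] → IsParameterSequence M (x.take i) := by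
  refine ⟨fun h i hi => ?_, fun h i hi hix => h i ?_⟩
  · rcases le_total i x.length with hix | hix
    · exact h i (Nat.one_le_iff_ne_zero.2 fun h₀ => hi (by simp [h₀])) hix
    · rw [List.take_of_length_le hix] at hi ⊢
      exact h.isParameterSequence hi
  · rw [← List.length_pos_iff, List.length_take]
    omega

theorem IsStrongParameterSequence.take {M : Type v} [AddCommGroup M] [Module A M]
    (h : IsStrongParameterSequence M x) (i : ℕ) : IsStrongParameterSequence M (x.take i) := by
  rw [isStrongParameterSequence_iff] at h ⊢
  intro j
  rw [List.take_take]
  exact h _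

theorem isRegular_take {M : Type v} [AddCommGroup M] [Module A M] (h : IsRegular M x) (i : ℕ) :
    IsRegular M (x.take i) := by
  have hx := h.toIsWeaklyRegular
  rw [← List.take_append_drop i x, isWeaklyRegular_append_iff] at hx
  refine ⟨hx.1, fun htop => h.top_ne_smul (top_le_iff.1 (htop.le.trans ?_)).symm⟩
  exact Submodule.smul_mono_left (Ideal.span_mono fun a ha => List.mem_of_mem_take ha)

theorem isRegular_self_iff : IsRegular A x ↔ IsWeaklyRegular A x ∧ Ideal.ofList x ≠ ⊤ := by
  rw [isRegular_iff, smul_eq_mul, Ideal.mul_top, ne_comm]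

theorem isParameterSequence_of_isRegular (hx : x ≠ []) (h : IsRegular A x) :
    IsParameterSequence A x := by
  obtain ⟨hreg, htop⟩ := isRegular_self_iff.1 h
  refine (isParameterSequence_iff hx).2
    ⟨isWeaklyProregular_of_isWeaklyRegular hreg, htop, fun p hp hvanish => ?_⟩
  obtain ⟨s, hs, k, hk⟩ := hvanish 1
  have hsx : s ∈ Ideal.ofList x • (⊤ : Submodule A A) := by
    refine mem_ofList_smul_top_of_prod_pow_smul_mem hreg k ?_
    rwa [smul_eq_mul, smul_eq_mul, Ideal.mul_top, mul_comm, add_comm]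
  rw [smul_eq_mul, Ideal.mul_top] at hsx
  exact hs (hp hsx)

theorem isStrongParameterSequence_of_isRegularSequence (h : IsRegularSequence A x) :
    IsStrongParameterSequence A x := by
  refine isStrongParameterSequence_iff.2 fun i hi => isParameterSequence_of_isRegular hi ?_
  rcases h with rfl | h
  · simp at hi
  · exact isRegular_take h i

end StrongParameter

/-! ### Trivial extensions -/

section TrivialExtension

open TrivSqZeroExt RingTheory.Sequence

theorem map_fst_map_inl {R : Type*} (M : Type*) [Zero M] (x : List R) :
    (x.map (inl : R → TrivSqZeroExt R M)).map fst = x := by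
  simp

variable {R : Type u} [CommRing R] {M : Type v} [AddCommGroup M] [Module R M] [Module Rᵐᵒᵖ M]
  [IsCentralScalar R M]

theorem inr_snd_pow_two (s : TrivSqZeroExt R M) : (inr s.snd : TrivSqZeroExt R M) ^ 2 = 0 := by
  rw [pow_two, inr_mul_inr]

theorem dvd_inl_fst_pow_two (s : TrivSqZeroExt R M) : s ∣ (inl s.fst : TrivSqZeroExt R M) ^ 2 := by
  refine ⟨inl s.fst - inr s.snd, ?_⟩
  linear_combination inr_snd_pow_two s + (inl s.fst - inr s.snd) * inl_fst_add_inr_snd_eq s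

theorem inl_fst_dvd_pow_two (s : TrivSqZeroExt R M) : (inl s.fst : TrivSqZeroExt R M) ∣ s ^ 2 := by
  refine ⟨inl s.fst + 2 * inr s.snd, ?_⟩
  linear_combination inr_snd_pow_two s - (s + inl s.fst + inr s.snd) * inl_fst_add_inr_snd_eq s

theorem isWeaklyProregular_trivSqZeroExt_iff {x : List R} :
    IsWeaklyProregular (TrivSqZeroExt R M) x ↔ IsWeaklyProregular R x ∧ IsWeaklyProregular M x := by
  rw [← isWeaklyProregular_prod_iff]
  constructor
  · refine isWeaklyProregular_of_retract
      (f := (Algebra.linearMap R (TrivSqZeroExt R M)).coprod (inrHom R M))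
      (g := (fstHom R R M).toLinearMap.prod (sndHom R M)) (LinearMap.ext fun a => ?_)
    simp [algebraMap_eq_inl]
  · refine isWeaklyProregular_of_retract
      (f := (fstHom R R M).toLinearMap.prod (sndHom R M))
      (g := (Algebra.linearMap R (TrivSqZeroExt R M)).coprod (inrHom R M))
      (LinearMap.ext fun s => ?_)
    simp [algebraMap_eq_inl, inl_fst_add_inr_snd_eq]

theorem isWeaklyProregular_iff_map_fst {y : List (TrivSqZeroExt R M)} :
    IsWeaklyProregular (TrivSqZeroExt R M) y ↔
      IsWeaklyProregular R (y.map fst) ∧ IsWeaklyProregular M (y.map fst) := by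
  rw [← isWeaklyProregular_trivSqZeroExt_iff,
    ← isWeaklyProregular_map_algebraMap_iff (R := R) (A := TrivSqZeroExt R M), algebraMap_eq_inl]
  obtain ⟨ℓ, y, rfl⟩ := exists_eq_ofFn y
  simp only [List.map_ofFn]
  exact ⟨isWeaklyProregular_ofFn_of_dvd_pow (fun j => inl_fst_dvd_pow_two (y j))
      (fun j => dvd_inl_fst_pow_two (y j)),
    isWeaklyProregular_ofFn_of_dvd_pow (fun j => dvd_inl_fst_pow_two (y j))
      (fun j => inl_fst_dvd_pow_two (y j))⟩

theorem comap_fstHom_comap_inlHom (q : Ideal (TrivSqZeroExt R M)) [q.IsPrime] :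
    (q.comap (inlHom R M)).comap (fstHom R R M) = q := by
  ext s
  have hnil : (inr s.snd : TrivSqZeroExt R M) ∈ q :=
    ‹q.IsPrime›.mem_of_pow_mem 2 (inr_snd_pow_two s ▸ q.zero_mem)
  have hmem := q.add_mem_iff_left (a := inl s.fst) hnil
  rw [inl_fst_add_inr_snd_eq] at hmem
  exact hmem.symm

theorem ofList_le_comap_fstHom_iff {y : List (TrivSqZeroExt R M)} {I : Ideal R} :
    Ideal.ofList y ≤ I.comap (fstHom R R M) ↔ Ideal.ofList (y.map fst) ≤ I := by
  simp [Ideal.ofList, Ideal.span_le, Set.subset_def]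

theorem ofList_eq_top_iff_map_fst {y : List (TrivSqZeroExt R M)} :
    Ideal.ofList y = ⊤ ↔ Ideal.ofList (y.map fst) = ⊤ := by
  constructor
  · intro htop
    rw [← Ideal.comap_eq_top_iff (f := fstHom R R M), eq_top_iff, ← htop,
      ofList_le_comap_fstHom_iff]
  · contrapose!
    intro hy htop
    obtain ⟨q, hq, hyq⟩ := Ideal.exists_le_maximal _ hy
    rw [← comap_fstHom_comap_inlHom q, ofList_le_comap_fstHom_iff, htop, top_le_iff] at hyq
    exact Ideal.IsPrime.ne_top inferInstance hyq

theorem topCechVanishes_comap_fstHom_iff {y : List (TrivSqZeroExt R M)} {p : Ideal R} [p.IsPrime] :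
    TopCechVanishes y (p.comap (fstHom R R M)).primeCompl ↔
      TopCechVanishes (y.map fst) p.primeCompl := by
  refine ⟨fun h => h.map (fstHom R R M).toRingHom fun s hs => hs, fun h => ?_⟩
  have hinl := h.map (T := (p.comap (fstHom R R M)).primeCompl) (inlHom R M) fun r hr => hr
  obtain ⟨ℓ, y, rfl⟩ := exists_eq_ofFn y
  simp only [List.map_ofFn] at hinl
  exact topCechVanishes_ofFn_of_dvd_pow (fun j => inl_fst_dvd_pow_two (y j))
    (fun j => dvd_inl_fst_pow_two (y j)) hinl

theorem isParameterSequence_iff_map_fst {y : List (TrivSqZeroExt R M)} (hy : y ≠ []) :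
    IsParameterSequence (TrivSqZeroExt R M) y ↔
      IsParameterSequence R (y.map fst) ∧ IsWeaklyProregular M (y.map fst) := by
  have hprimes : (∀ q : PrimeSpectrum (TrivSqZeroExt R M), Ideal.ofList y ≤ q.asIdeal →
        ¬ TopCechVanishes y q.asIdeal.primeCompl) ↔
      ∀ p : PrimeSpectrum R, Ideal.ofList (y.map fst) ≤ p.asIdeal →
        ¬ TopCechVanishes (y.map fst) p.asIdeal.primeCompl := by
    simp only [← topCechVanishes_comap_fstHom_iff, ← ofList_le_comap_fstHom_iff]
    refine ⟨fun h p => h (p.comap (fstHom R R M).toRingHom), fun h q => ?_⟩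
    have hq := h (q.comap (inlHom R M))
    simp only [PrimeSpectrum.comap_asIdeal, comap_fstHom_comap_inlHom] at hq
    exact hq
  rw [isParameterSequence_iff hy, isParameterSequence_iff (List.map_eq_nil_iff.not.2 hy),
    isWeaklyProregular_iff_map_fst, Ne, ofList_eq_top_iff_map_fst, hprimes]
  tauto

theorem isStrongParameterSequence_iff_map_fst {y : List (TrivSqZeroExt R M)} :
    IsStrongParameterSequence (TrivSqZeroExt R M) y ↔
      IsStrongParameterSequence R (y.map fst) ∧
        ∀ i, IsWeaklyProregular M ((y.map fst).take i) := by
  simp only [isStrongParameterSequence_iff, ← List.map_take, ← forall_and]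
  refine forall_congr' fun i => ?_
  rcases eq_or_ne (y.take i) [] with hi | hi
  · simpa [hi] using isWeaklyProregular_of_isWeaklyRegular (.nil R M)
  · simp only [isParameterSequence_iff_map_fst hi, forall_const, ne_eq, hi, not_false_eq_true,
      List.map_eq_nil_iff]

theorem isWeaklyRegular_of_map_fst {y : List (TrivSqZeroExt R M)}
    (hR : IsWeaklyRegular R (y.map fst)) (hM : IsWeaklyRegular M (y.map fst)) :
    IsWeaklyRegular (TrivSqZeroExt R M) y := by
  let : Algebra (TrivSqZeroExt R M) R := (fstHom R R M).toRingHom.toAlgebra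
  let : Module (TrivSqZeroExt R M) M := Module.compHom M (fstHom R R M).toRingHom
  have : IsScalarTower (TrivSqZeroExt R M) R M := ⟨fun s r m => mul_smul s.fst r m⟩
  let ι : M →ₗ[TrivSqZeroExt R M] TrivSqZeroExt R M :=
    { toFun := inr
      map_add' := inr_add R
      map_smul' := fun s m => by
        change inr (s.fst • m) = s * inr m
        ext <;> simp }
  have hexact : Function.Exact ι (Algebra.linearMap (TrivSqZeroExt R M) R) := fun s =>
    ⟨fun h => ⟨s.snd, TrivSqZeroExt.ext (Eq.symm h) rfl⟩, by rintro ⟨m, rfl⟩; rfl⟩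
  exact isWeaklyRegular_of_exact inr_injective hexact (fun r => ⟨inl r, fst_inl M r⟩)
    ((isWeaklyRegular_map_algebraMap_iff R M y).1 hM)
    ((isWeaklyRegular_map_algebraMap_iff R R y).1 hR)

theorem isWeaklyRegular_of_map_inl {x : List R}
    (h : IsWeaklyRegular (TrivSqZeroExt R M) (x.map (inl : R → TrivSqZeroExt R M))) :
    IsWeaklyRegular R x ∧ IsWeaklyRegular M x := by
  have hx : IsWeaklyRegular (TrivSqZeroExt R M) x :=
    (isWeaklyRegular_map_algebraMap_iff (TrivSqZeroExt R M) (TrivSqZeroExt R M) x).1 h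
  exact ⟨isWeaklyRegular_of_retract (f := Algebra.linearMap R (TrivSqZeroExt R M))
      (g := (fstHom R R M).toLinearMap) (LinearMap.ext fun _ => rfl) hx,
    isWeaklyRegular_of_retract (f := inrHom R M) (g := sndHom R M) (LinearMap.ext fun _ => rfl) hx⟩

theorem isRegularSequence_of_map_fst {y : List (TrivSqZeroExt R M)}
    (hR : IsRegularSequence R (y.map fst)) (hM : IsWeaklyRegular M (y.map fst)) :
    IsRegularSequence (TrivSqZeroExt R M) y := by
  refine hR.imp List.map_eq_nil_iff.1 fun hR => ?_
  rw [isRegular_self_iff, Ne, ← ofList_eq_top_iff_map_fst] at hR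
  exact isRegular_self_iff.2 ⟨isWeaklyRegular_of_map_fst hR.1 hM, hR.2⟩

theorem isRegularSequence_and_isWeaklyRegular_of_map_inl {x : List R}
    (h : IsRegularSequence (TrivSqZeroExt R M) (x.map (inl : R → TrivSqZeroExt R M))) :
    IsRegularSequence R x ∧ IsWeaklyRegular M x := by
  rcases h with h | h
  · obtain rfl := List.map_eq_nil_iff.1 h
    exact ⟨.inl rfl, .nil R M⟩
  · rw [isRegular_self_iff, Ne, ofList_eq_top_iff_map_fst, map_fst_map_inl] at h
    obtain ⟨hR, hM⟩ := isWeaklyRegular_of_map_inl h.1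
    exact ⟨.inr (isRegular_self_iff.2 ⟨hR, h.2⟩), hM⟩

end TrivialExtension

end HamiltonMarley

end

open HamiltonMarley in
theorem mainTheorem1_general {R : Type u} [CommRing R] {M : Type v} [AddCommGroup M] [Module R M]
    [Module Rᵐᵒᵖ M] [IsCentralScalar R M] :
    (IsCohenMacaulayRing (TrivSqZeroExt R M) ∧
        ∀ x : List R, IsStrongParameterSequence R x → IsWeaklyProregular M x) ↔
      IsCohenMacaulayRing R ∧
        ∀ x : List R, IsRegularSequence R x → RingTheory.Sequence.IsWeaklyRegular M x := by
  constructor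
  · rintro ⟨hS, hM⟩
    have hreg (x : List R) (hx : IsStrongParameterSequence R x) :
        IsRegularSequence R x ∧ RingTheory.Sequence.IsWeaklyRegular M x := by
      refine isRegularSequence_and_isWeaklyRegular_of_map_inl (hS _ ?_)
      rw [isStrongParameterSequence_iff_map_fst, map_fst_map_inl]
      exact ⟨hx, fun i => hM _ (hx.take i)⟩
    exact ⟨fun x hx => (hreg x hx).1,
      fun x hx => (hreg x (isStrongParameterSequence_of_isRegularSequence hx)).2⟩
  · rintro ⟨hR, hM⟩
    refine ⟨fun y hy => ?_, fun x hx => isWeaklyProregular_of_isWeaklyRegular (hM x (hR x hx))⟩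
    have hreg := hR _ (isStrongParameterSequence_iff_map_fst.1 hy).1
    exact isRegularSequence_of_map_fst hreg (hM _ hreg)

/-- The trivial extension `R ⋉ M` is `TrivSqZeroExt R M`; the right action of `R` on `M` that its
ring structure mentions is the given one, by `IsCentralScalar R M`. -/
theorem mainTheorem1 {R : Type u} [CommRing R] {M : Type v} [AddCommGroup M] [Module R M]
    [Module Rᵐᵒᵖ M] [IsCentralScalar R M] :
    ((∀ x : List R,
        HamiltonMarley.IsWeaklyProregular R x → HamiltonMarley.IsWeaklyProregular M x) →
      (HamiltonMarley.IsCohenMacaulayRing (TrivSqZeroExt R M) ↔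
        HamiltonMarley.IsCohenMacaulayRing R ∧
          ∀ x : List R, HamiltonMarley.IsRegularSequence R x →
            RingTheory.Sequence.IsWeaklyRegular M x)) ∧
    ((HamiltonMarley.IsCohenMacaulayRing R ∧
        ∀ x : List R, HamiltonMarley.IsRegularSequence R x →
          RingTheory.Sequence.IsWeaklyRegular M x) →
      HamiltonMarley.IsCohenMacaulayRing (TrivSqZeroExt R M)) :=
  ⟨fun H => (and_iff_left fun x hx => H x hx.isWeaklyProregular).symm.trans mainTheorem1_general,
    fun h => (mainTheorem1_general.2 h).1⟩
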